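/- Let $\mathcal R$ be a connected metric graph with finitely many edges $e_k$, $k\in I=I_B\cup I_U$ (disjoint finite sets, $I_U\neq\emptyset$): for $k\in I_B$ the edge $e_k$ is identified with $(0,\ell_k)$, $0<\ell_k<\infty$, with a vertex at each end; for $k\in I_U$ the edge $e_k$ is identified with $(0,\infty)$, with a vertex at $0$. Loops and multiple edges are allowed. For a vertex $v$ let $I_v$ be the set of edges having $v$ as a vertex; $v$ is exterior if $\# I_v=1$ and interior if $\# I_v\ge 2$. Let $L^2(\mathcal R)=\prod_{k\in I}L^2(e_k)$ be the Hilbert space product of the complex spaces $L^2(e_k)$, and let $H$ be the operator $Hu=(-u_k'')_{k\in I}$ on $L^2(\mathcal R)$ whose domain $\mathcal D(H)$ consists of the $u=(u_k)\in\prod_{k\in I}H^2(e_k)$ that are continuous on $\mathcal R$, vanish at every exterior vertex, and satisfy at every interior vertex $v$ the Kirchhoff condition that the outward normal derivatives at $v$ ($-u_k'(0)$ at the end $0$ of an edge, $u_k'(\ell_k)$ at the end $\ell_k$; both ends of a loop count) sum to $0$. Then $-iH$ generates a strongly continuous one-parameter group $(e^{-itH})_{t\in\mathbb R}$ on $L^2(\mathcal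 R)$. Moreover let $u_0\in\mathcal D(H)$ and $u(t)=e^{-itH}u_0$. Then for every $t\in\mathbb R$ we have $u(t)\in\mathcal D(H)$, the two functions $\sum_{k\in I_B}\int_{e_k}\rho_k$ and $\sum_{k\in I_B}\|u_k\|_{L^2(e_k)}^2$ are differentiable at $t$, and $$ i\frac{d}{dt}\sum_{k\in I_B}\int_{e_k}\rho_k \;=\; i\frac{d}{dt}\sum_{k\in I_B}\|u_k\|_{L^2(e_k)}^2 \;=\; -\sum_{k\in I_U} j_k(0), $$ where $\rho_k=|u_k|^2$ and $j_k=\overline{u_k}\,\partial_x u_k-u_k\,\overline{\partial_x u_k}$ are the probability density and the probability flow on $e_k$. -/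

import Mathlib

open MeasureTheory Filter Topology

noncomputable section

/-! ## Square integrable functions on an open set of the line, weak derivatives, point values -/

namespace QuantumGraph

/-- `L²(Ω; ℂ)` for `Ω ⊆ ℝ` with Lebesgue measure. -/
abbrev L2 (Ω : Set ℝ) : Type := Lp ℂ 2 (volume.restrict Ω)

/-- `g ∈ L²(Ω)` is the weak derivative of `f ∈ L²(Ω)`: `∫ φ' f = - ∫ φ g` for every test function
`φ ∈ C_c^∞(Ω)`. -/
def HasWeakDeriv (Ω : Set ℝ) (f g : L2 Ω) : Prop :=
  ∀ φ : ℝ → ℝ, ContDiff ℝ (⊤ : ℕ∞) φ → HasCompactSupport φ → tsupport φ ⊆ Ω →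
    ∫ x in Ω, deriv φ x • f x = -∫ x in Ω, φ x • g x

lemma integrable_smul_L2 {Ω : Set ℝ} {φ : ℝ → ℝ} (hφ : Continuous φ) (hc : HasCompactSupport φ)
    (f : L2 Ω) : Integrable (fun x => φ x • f x) (volume.restrict Ω) := by
  have h1 : MemLp φ 2 (volume.restrict Ω) := hφ.memLp_of_hasCompactSupport hc
  have h2 : MemLp (f : ℝ → ℂ) 2 (volume.restrict Ω) := Lp.memLp f
  exact memLp_one_iff_integrable.mp (h2.smul h1)

lemma integral_smul_add {Ω : Set ℝ} {φ : ℝ → ℝ} (hφ : Continuous φ) (hc : HasCompactSupport φ)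
    (f f' : L2 Ω) : ∫ x in Ω, φ x • (f + f' : L2 Ω) x =
      (∫ x in Ω, φ x • f x) + ∫ x in Ω, φ x • f' x := by
  rw [← integral_add (integrable_smul_L2 hφ hc f) (integrable_smul_L2 hφ hc f')]
  refine integral_congr_ae ?_
  filter_upwards [Lp.coeFn_add f f'] with x hx
  simp only [hx, Pi.add_apply, smul_add]

lemma integral_smul_smul {Ω : Set ℝ} (φ : ℝ → ℝ) (c : ℂ) (f : L2 Ω) :
    ∫ x in Ω, φ x • (c • f : L2 Ω) x = c • ∫ x in Ω, φ x • f x := by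
  rw [← integral_smul]
  refine integral_congr_ae ?_
  filter_upwards [Lp.coeFn_smul c f] with x hx
  simp only [hx, Pi.smul_apply, smul_comm c]

lemma HasWeakDeriv.add {Ω : Set ℝ} {f g f' g' : L2 Ω} (h : HasWeakDeriv Ω f g)
    (h' : HasWeakDeriv Ω f' g') : HasWeakDeriv Ω (f + f') (g + g') := by
  intro φ hφ hc hs
  rw [integral_smul_add (hφ.continuous_deriv (by simp)) hc.deriv,
    integral_smul_add hφ.continuous hc, h φ hφ hc hs, h' φ hφ hc hs, neg_add]

lemma HasWeakDeriv.smul {Ω : Set ℝ} {f g : L2 Ω} (c : ℂ) (h : HasWeakDeriv Ω f g) :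
    HasWeakDeriv Ω (c • f) (c • g) := by
  intro φ hφ hc hs
  rw [integral_smul_smul, integral_smul_smul, h φ hφ hc hs, smul_neg]

lemma HasWeakDeriv.unique {Ω : Set ℝ} (hΩ : IsOpen Ω) {f g g' : L2 Ω} (h : HasWeakDeriv Ω f g)
    (h' : HasWeakDeriv Ω f g') : g = g' := by
  have h0 : HasWeakDeriv Ω (0 : L2 Ω) (g - g') := by
    have := h.add (h'.smul (-1))
    simpa [sub_eq_add_neg] using this
  have hloc : LocallyIntegrableOn (fun x => (g - g' : L2 Ω) x) Ω volume :=
    fun x hx => by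
      have hm : MemLp (fun x => (g - g' : L2 Ω) x) 2 (volume.restrict Ω) := Lp.memLp _
      exact (locallyIntegrableOn_of_locallyIntegrable_restrict
        (hm.locallyIntegrable (by norm_num))) x hx
  have key := hΩ.ae_eq_zero_of_integral_contDiff_smul_eq_zero hloc (fun φ hφ hc hs => by
    have h1 := h0 φ hφ hc hs
    have h2 : ∫ x in Ω, deriv φ x • (0 : L2 Ω) x = 0 := by
      simpa using integral_smul_smul (deriv φ) 0 (0 : L2 Ω)
    rw [h2] at h1
    have h3 : ∫ x in Ω, φ x • (g - g' : L2 Ω) x = 0 := by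
      simpa using h1.symm
    rw [← h3]
    refine (setIntegral_eq_integral_of_forall_compl_eq_zero fun x hx => ?_).symm
    rw [image_eq_zero_of_notMem_tsupport fun hh => hx (hs hh), zero_smul])
  rw [← sub_eq_zero]
  refine Lp.ext ?_
  filter_upwards [(ae_restrict_iff' hΩ.measurableSet).mpr key,
    Lp.coeFn_zero ℂ 2 (volume.restrict Ω)] with x hx hx0
  rw [hx, hx0, Pi.zero_apply]

/-- The weak derivative in `L²(Ω)` of an element of `H¹(Ω)` (and `0` off `H¹(Ω)`). -/
def weakDeriv (Ω : Set ℝ) (f : L2 Ω) : L2 Ω :=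
  open Classical in if h : ∃ g, HasWeakDeriv Ω f g then h.choose else 0

lemma HasWeakDeriv.weakDeriv_eq {Ω : Set ℝ} (hΩ : IsOpen Ω) {f g : L2 Ω}
    (h : HasWeakDeriv Ω f g) : weakDeriv Ω f = g := by
  have hex : ∃ g, HasWeakDeriv Ω f g := ⟨g, h⟩
  rw [weakDeriv, dif_pos hex]
  exact hex.choose_spec.unique hΩ h

/-- The Sobolev space `H²(Ω)`: `f`, `f'` and `f''` (weak derivatives) all belong to `L²(Ω)`. -/
def MemH2 (Ω : Set ℝ) (f : L2 Ω) : Prop :=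
  ∃ g h : L2 Ω, HasWeakDeriv Ω f g ∧ HasWeakDeriv Ω g h

/-- `g` is a representative of the class `f` that is continuous up to the boundary of `Ω`. -/
def IsContRep (Ω : Set ℝ) (f : L2 Ω) (g : ℝ → ℂ) : Prop :=
  ContinuousOn g (closure Ω) ∧ (f : ℝ → ℂ) =ᵐ[volume.restrict Ω] g

lemma IsContRep.eqOn {Ω : Set ℝ} (hΩ : IsOpen Ω) {f : L2 Ω} {g g' : ℝ → ℂ}
    (h : IsContRep Ω f g) (h' : IsContRep Ω f g') : Set.EqOn g g' (closure Ω) :=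
  (Measure.eqOn_open_of_ae_eq (h.2.symm.trans h'.2) hΩ (h.1.mono subset_closure)
    (h'.1.mono subset_closure)).of_subset_closure h.1 h'.1 subset_closure subset_rfl

lemma IsContRep.add {Ω : Set ℝ} {f f' : L2 Ω} {g g' : ℝ → ℂ}
    (h : IsContRep Ω f g) (h' : IsContRep Ω f' g') : IsContRep Ω (f + f') (g + g') :=
  ⟨h.1.add h'.1, (Lp.coeFn_add f f').trans (h.2.add h'.2)⟩

lemma IsContRep.smul {Ω : Set ℝ} {f : L2 Ω} {g : ℝ → ℂ} (c : ℂ)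
    (h : IsContRep Ω f g) : IsContRep Ω (c • f) (c • g) :=
  ⟨h.1.const_smul c, (Lp.coeFn_smul c f).trans (h.2.const_smul c)⟩

/-- `pointValue Ω f x` is the value at `x ∈ closure Ω` of the representative of `f` that is
continuous up to the boundary of `Ω` (and `0` if there is none). -/
def pointValue (Ω : Set ℝ) (f : L2 Ω) : ℝ → ℂ :=
  open Classical in if h : ∃ g, IsContRep Ω f g then h.choose else 0

lemma IsContRep.pointValue_eq {Ω : Set ℝ} (hΩ : IsOpen Ω) {f : L2 Ω} {g : ℝ → ℂ}
    (h : IsContRep Ω f g) {x : ℝ} (hx : x ∈ closure Ω) : pointValue Ω f x = g x := by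
  have hex : ∃ g, IsContRep Ω f g := ⟨g, h⟩
  rw [pointValue, dif_pos hex]
  exact hex.choose_spec.eqOn hΩ h hx

/-- The functions of `H²(Ω)` that are `C¹` up to the boundary of `Ω`. For an interval `Ω` every
element of `H²(Ω)` is of this kind (Sobolev embedding); the second and third parts only record that
the point values of `f` and `f'` on `closure Ω` make sense. -/
structure IsC1H2 (Ω : Set ℝ) (f : L2 Ω) : Prop where
  memH2 : MemH2 Ω f
  contRep : ∃ g, IsContRep Ω f g
  contRep_deriv : ∃ g, IsContRep Ω (weakDeriv Ω f) g

lemma weakDeriv_add {Ω : Set ℝ} (hΩ : IsOpen Ω) {f f' : L2 Ω} (h : ∃ g, HasWeakDeriv Ω f g)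
    (h' : ∃ g, HasWeakDeriv Ω f' g) :
    weakDeriv Ω (f + f') = weakDeriv Ω f + weakDeriv Ω f' := by
  obtain ⟨g, hg⟩ := h
  obtain ⟨g', hg'⟩ := h'
  rw [(hg.add hg').weakDeriv_eq hΩ, hg.weakDeriv_eq hΩ, hg'.weakDeriv_eq hΩ]

lemma weakDeriv_smul {Ω : Set ℝ} (hΩ : IsOpen Ω) {f : L2 Ω} (c : ℂ)
    (h : ∃ g, HasWeakDeriv Ω f g) : weakDeriv Ω (c • f) = c • weakDeriv Ω f := by
  obtain ⟨g, hg⟩ := h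
  rw [(hg.smul c).weakDeriv_eq hΩ, hg.weakDeriv_eq hΩ]

lemma MemH2.hasWeakDeriv {Ω : Set ℝ} {f : L2 Ω} (h : MemH2 Ω f) : ∃ g, HasWeakDeriv Ω f g :=
  ⟨h.choose, h.choose_spec.choose_spec.1⟩

lemma MemH2.hasWeakDeriv' {Ω : Set ℝ} (hΩ : IsOpen Ω) {f : L2 Ω} (h : MemH2 Ω f) :
    ∃ g, HasWeakDeriv Ω (weakDeriv Ω f) g := by
  obtain ⟨g, k, h1, h2⟩ := h
  rw [h1.weakDeriv_eq hΩ]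
  exact ⟨k, h2⟩

lemma pointValue_add {Ω : Set ℝ} (hΩ : IsOpen Ω) {f f' : L2 Ω} (h : ∃ g, IsContRep Ω f g)
    (h' : ∃ g, IsContRep Ω f' g) {x : ℝ} (hx : x ∈ closure Ω) :
    pointValue Ω (f + f') x = pointValue Ω f x + pointValue Ω f' x := by
  obtain ⟨g, hg⟩ := h
  obtain ⟨g', hg'⟩ := h'
  rw [(hg.add hg').pointValue_eq hΩ hx, hg.pointValue_eq hΩ hx, hg'.pointValue_eq hΩ hx,
    Pi.add_apply]

lemma pointValue_smul {Ω : Set ℝ} (hΩ : IsOpen Ω) {f : L2 Ω} (c : ℂ)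
    (h : ∃ g, IsContRep Ω f g) {x : ℝ} (hx : x ∈ closure Ω) :
    pointValue Ω (c • f) x = c * pointValue Ω f x := by
  obtain ⟨g, hg⟩ := h
  rw [(hg.smul c).pointValue_eq hΩ hx, hg.pointValue_eq hΩ hx, Pi.smul_apply, smul_eq_mul]

lemma IsC1H2.add {Ω : Set ℝ} (hΩ : IsOpen Ω) {f f' : L2 Ω} (h : IsC1H2 Ω f)
    (h' : IsC1H2 Ω f') : IsC1H2 Ω (f + f') := by
  refine ⟨?_, ?_, ?_⟩
  · obtain ⟨g, k, h1, h2⟩ := h.memH2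
    obtain ⟨g', k', h1', h2'⟩ := h'.memH2
    exact ⟨g + g', k + k', h1.add h1', h2.add h2'⟩
  · obtain ⟨g, hg⟩ := h.contRep
    obtain ⟨g', hg'⟩ := h'.contRep
    exact ⟨g + g', hg.add hg'⟩
  · obtain ⟨g, hg⟩ := h.contRep_deriv
    obtain ⟨g', hg'⟩ := h'.contRep_deriv
    rw [weakDeriv_add hΩ h.memH2.hasWeakDeriv h'.memH2.hasWeakDeriv]
    exact ⟨g + g', hg.add hg'⟩

lemma IsC1H2.smul {Ω : Set ℝ} (hΩ : IsOpen Ω) {f : L2 Ω} (c : ℂ) (h : IsC1H2 Ω f) :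
    IsC1H2 Ω (c • f) := by
  refine ⟨?_, ?_, ?_⟩
  · obtain ⟨g, k, h1, h2⟩ := h.memH2
    exact ⟨c • g, c • k, h1.smul c, h2.smul c⟩
  · obtain ⟨g, hg⟩ := h.contRep
    exact ⟨c • g, hg.smul c⟩
  · obtain ⟨g, hg⟩ := h.contRep_deriv
    rw [weakDeriv_smul hΩ c h.memH2.hasWeakDeriv]
    exact ⟨c • g, hg.smul c⟩

lemma hasWeakDeriv_zero (Ω : Set ℝ) : HasWeakDeriv Ω (0 : L2 Ω) 0 := by
  intro φ _ _ _
  have h : ∀ ψ : ℝ → ℝ, ∫ x in Ω, ψ x • (0 : L2 Ω) x = 0 := by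
    intro ψ
    simpa using integral_smul_smul ψ 0 (0 : L2 Ω)
  rw [h, h, neg_zero]

lemma isContRep_zero (Ω : Set ℝ) : IsContRep Ω (0 : L2 Ω) 0 :=
  ⟨continuousOn_const, Lp.coeFn_zero ℂ 2 (volume.restrict Ω)⟩

lemma isC1H2_zero {Ω : Set ℝ} (hΩ : IsOpen Ω) : IsC1H2 Ω (0 : L2 Ω) := by
  refine ⟨⟨0, 0, hasWeakDeriv_zero Ω, hasWeakDeriv_zero Ω⟩, ⟨0, isContRep_zero Ω⟩, ?_⟩
  rw [(hasWeakDeriv_zero Ω).weakDeriv_eq hΩ]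
  exact ⟨0, isContRep_zero Ω⟩

/-- The probability density `ρ = |f|²`. -/
def probDensity (Ω : Set ℝ) (f : L2 Ω) (x : ℝ) : ℝ := ‖f x‖ ^ 2

/-- The probability flow `j(x) = conj (f x) * f' x - f x * conj (f' x)`. -/
def probFlow (Ω : Set ℝ) (f : L2 Ω) (x : ℝ) : ℂ :=
  (starRingEnd ℂ) (pointValue Ω f x) * pointValue Ω (weakDeriv Ω f) x -
    pointValue Ω f x * (starRingEnd ℂ) (pointValue Ω (weakDeriv Ω f) x)

/-! ## Strongly continuous groups of operators -/

/-- `T` is a strongly continuous one-parameter group of bounded operators on `E` whose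
infinitesimal generator, with its exact domain, is the (possibly unbounded) operator `A`. -/
structure IsC0GroupGeneratedBy {E : Type*} [NormedAddCommGroup E] [NormedSpace ℂ E]
    (A : E →ₗ.[ℂ] E) (T : ℝ → E →L[ℂ] E) : Prop where
  map_zero : T 0 = 1
  map_add : ∀ s t, T (s + t) = T s * T t
  continuous : ∀ x, Continuous fun t => T t x
  generator : ∀ x y, (x, y) ∈ A.graph ↔
    Tendsto (fun t : ℝ => (t : ℂ)⁻¹ • (T t x - x)) (𝓝[≠] 0) (𝓝 y)

/-- The group `t ↦ e^{tA}` generated by `A`; a group is determined by its generator. The value is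
`0` if `A` is not the generator of such a group. -/
def expGroup {E : Type*} [NormedAddCommGroup E] [NormedSpace ℂ E] (A : E →ₗ.[ℂ] E) :
    ℝ → E →L[ℂ] E :=
  open Classical in if h : ∃ T, IsC0GroupGeneratedBy A T then h.choose else 0

end QuantumGraph

/-! ## Metric graphs with finitely many edges -/

open QuantumGraph

/-- A connected metric graph with vertex set `V`, bounded edges indexed by `B` and unbounded edges
indexed by `U`. The bounded edge `b` is the interval `(0, len b)`, glued at `0` to the vertex
`start b` and at `len b` to `finish b` (loops and multiple edges are allowed); the unbounded edge
`k` is `(0, ∞)`, glued at `0` to `root k`. As every half-line is attached to a vertex, connectedness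
means that any two vertices are joined by a chain of bounded edges. -/
structure MetricGraph (V B U : Type*) where
  len : B → ℝ
  len_pos : ∀ b, 0 < len b
  start : B → V
  finish : B → V
  root : U → V
  nonempty_unbounded : Nonempty U
  connected : (SimpleGraph.fromRel fun v w => ∃ b, start b = v ∧ finish b = w).Connected

namespace MetricGraph

variable {V B U : Type*} (G : MetricGraph V B U)

/-- The open interval identified with an edge. -/
def edge : B ⊕ U → Set ℝ
  | Sum.inl b => Set.Ioo 0 (G.len b)
  | Sum.inr _ => Set.Ioi 0

lemma isOpen_edge (k : B ⊕ U) : IsOpen (G.edge k) := by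
  cases k
  · exact isOpen_Ioo
  · exact isOpen_Ioi

lemma zero_mem_closure_edge (k : B ⊕ U) : (0 : ℝ) ∈ closure (G.edge k) := by
  cases k with
  | inl b =>
    rw [edge, closure_Ioo (G.len_pos b).ne]
    exact Set.left_mem_Icc.mpr (G.len_pos b).le
  | inr k =>
    rw [edge, closure_Ioi]
    exact Set.self_mem_Ici

lemma len_mem_closure_edge (b : B) : G.len b ∈ closure (G.edge (Sum.inl b)) := by
  rw [edge, closure_Ioo (G.len_pos b).ne]
  exact Set.right_mem_Icc.mpr (G.len_pos b).le

/-- `I_v`, the set of edges having `v` as a vertex. -/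
def incident (v : V) : Set (B ⊕ U) :=
  {k | match k with
    | Sum.inl b => G.start b = v ∨ G.finish b = v
    | Sum.inr k => G.root k = v}

/-- Exterior vertices: `#I_v = 1`. -/
def IsExterior (v : V) : Prop := (G.incident v).ncard = 1

/-- Interior vertices: `#I_v ≥ 2`. -/
def IsInterior (v : V) : Prop := 2 ≤ (G.incident v).ncard

variable [Fintype B] [Fintype U]

/-- `L²` of the graph: the Hilbert space product of the spaces `L²(e_k)`. -/
abbrev L2Graph : Type _ := PiLp 2 fun k : B ⊕ U => L2 (G.edge k)

/-- The value of `u_k` at `x`, for `x` in the closed edge. -/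
def val (u : G.L2Graph) (k : B ⊕ U) (x : ℝ) : ℂ := pointValue (G.edge k) (u k) x

/-- The value of the derivative of `u_k` at `x`, for `x` in the closed edge. -/
def derivVal (u : G.L2Graph) (k : B ⊕ U) (x : ℝ) : ℂ :=
  pointValue (G.edge k) (weakDeriv (G.edge k) (u k)) x

open Classical in
/-- The sum over the edge ends at `v` of the outward normal derivatives of `u`. The outward normal
derivative is `-u_k'(0)` at the end `0` of an edge and `u_k'(len k)` at the other end. A loop has
two ends at its vertex. -/
def normalDerivSum (u : G.L2Graph) (v : V) : ℂ :=
  (∑ b : B, if G.start b = v then -G.derivVal u (Sum.inl b) 0 else 0) +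
    (∑ b : B, if G.finish b = v then G.derivVal u (Sum.inl b) (G.len b) else 0) +
    ∑ k : U, if G.root k = v then -G.derivVal u (Sum.inr k) 0 else 0

/-- The domain of the Hamiltonian: `u` is `H²` on every edge and continuous on the graph (with value
`c v` at the vertex `v`), vanishes at the exterior vertices, and satisfies the Kirchhoff condition
at the interior vertices. -/
structure MemDomain (u : G.L2Graph) : Prop where
  edgewise : ∀ k, IsC1H2 (G.edge k) (u k)
  vertex : ∃ c : V → ℂ, (∀ b, G.val u (Sum.inl b) 0 = c (G.start b)) ∧
    (∀ b, G.val u (Sum.inl b) (G.len b) = c (G.finish b)) ∧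
    (∀ k, G.val u (Sum.inr k) 0 = c (G.root k)) ∧
    ∀ v, G.IsExterior v → c v = 0
  kirchhoff : ∀ v, G.IsInterior v → G.normalDerivSum u v = 0

variable {G}

lemma val_add {u v : G.L2Graph} (hu : G.MemDomain u) (hv : G.MemDomain v) (k : B ⊕ U) {x : ℝ}
    (hx : x ∈ closure (G.edge k)) : G.val (u + v) k x = G.val u k x + G.val v k x :=
  pointValue_add (G.isOpen_edge k) (hu.edgewise k).contRep (hv.edgewise k).contRep hx

lemma val_smul {u : G.L2Graph} (c : ℂ) (hu : G.MemDomain u) (k : B ⊕ U) {x : ℝ}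
    (hx : x ∈ closure (G.edge k)) : G.val (c • u) k x = c * G.val u k x :=
  pointValue_smul (G.isOpen_edge k) c (hu.edgewise k).contRep hx

lemma derivVal_add {u v : G.L2Graph} (hu : G.MemDomain u) (hv : G.MemDomain v) (k : B ⊕ U)
    {x : ℝ} (hx : x ∈ closure (G.edge k)) :
    G.derivVal (u + v) k x = G.derivVal u k x + G.derivVal v k x := by
  rw [derivVal, PiLp.add_apply, weakDeriv_add (G.isOpen_edge k)
    (hu.edgewise k).memH2.hasWeakDeriv (hv.edgewise k).memH2.hasWeakDeriv]
  exact pointValue_add (G.isOpen_edge k) (hu.edgewise k).contRep_deriv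
    (hv.edgewise k).contRep_deriv hx

lemma derivVal_smul {u : G.L2Graph} (c : ℂ) (hu : G.MemDomain u) (k : B ⊕ U) {x : ℝ}
    (hx : x ∈ closure (G.edge k)) : G.derivVal (c • u) k x = c * G.derivVal u k x := by
  rw [derivVal, PiLp.smul_apply, weakDeriv_smul (G.isOpen_edge k) c
    (hu.edgewise k).memH2.hasWeakDeriv]
  exact pointValue_smul (G.isOpen_edge k) c (hu.edgewise k).contRep_deriv hx

lemma normalDerivSum_add {u v : G.L2Graph} (hu : G.MemDomain u) (hv : G.MemDomain v) (w : V) :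
    G.normalDerivSum (u + v) w = G.normalDerivSum u w + G.normalDerivSum v w := by
  have h0 := fun k => derivVal_add hu hv k (G.zero_mem_closure_edge k)
  have h1 := fun b => derivVal_add hu hv (Sum.inl b) (G.len_mem_closure_edge b)
  have e : ∀ (p : Prop) [Decidable p] (a b : ℂ),
      (if p then a + b else 0) = (if p then a else 0) + if p then b else 0 := by
    intro p _ a b
    split_ifs <;> simp
  simp only [normalDerivSum, h0, h1, neg_add, e, Finset.sum_add_distrib]
  ring

lemma normalDerivSum_smul {u : G.L2Graph} (c : ℂ) (hu : G.MemDomain u) (w : V) :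
    G.normalDerivSum (c • u) w = c * G.normalDerivSum u w := by
  have h0 := fun k => derivVal_smul c hu k (G.zero_mem_closure_edge k)
  have h1 := fun b => derivVal_smul c hu (Sum.inl b) (G.len_mem_closure_edge b)
  simp only [normalDerivSum, h0, h1, mul_add, Finset.mul_sum, mul_ite, mul_zero, mul_neg]

lemma MemDomain.add {u v : G.L2Graph} (hu : G.MemDomain u) (hv : G.MemDomain v) :
    G.MemDomain (u + v) := by
  refine ⟨fun k => (hu.edgewise k).add (G.isOpen_edge k) (hv.edgewise k), ?_, fun w hw => ?_⟩
  · obtain ⟨c, h1, h2, h3, h4⟩ := hu.vertex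
    obtain ⟨d, k1, k2, k3, k4⟩ := hv.vertex
    refine ⟨c + d, fun b => ?_, fun b => ?_, fun k => ?_, fun w hw => ?_⟩
    · rw [val_add hu hv _ (G.zero_mem_closure_edge _), h1, k1, Pi.add_apply]
    · rw [val_add hu hv _ (G.len_mem_closure_edge _), h2, k2, Pi.add_apply]
    · rw [val_add hu hv _ (G.zero_mem_closure_edge _), h3, k3, Pi.add_apply]
    · rw [Pi.add_apply, h4 w hw, k4 w hw, add_zero]
  · rw [normalDerivSum_add hu hv, hu.kirchhoff w hw, hv.kirchhoff w hw, add_zero]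

lemma MemDomain.smul {u : G.L2Graph} (c : ℂ) (hu : G.MemDomain u) : G.MemDomain (c • u) := by
  refine ⟨fun k => (hu.edgewise k).smul (G.isOpen_edge k) c, ?_, fun w hw => ?_⟩
  · obtain ⟨d, k1, k2, k3, k4⟩ := hu.vertex
    refine ⟨c • d, fun b => ?_, fun b => ?_, fun k => ?_, fun w hw => ?_⟩
    · rw [val_smul c hu _ (G.zero_mem_closure_edge _), k1, Pi.smul_apply, smul_eq_mul]
    · rw [val_smul c hu _ (G.len_mem_closure_edge _), k2, Pi.smul_apply, smul_eq_mul]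
    · rw [val_smul c hu _ (G.zero_mem_closure_edge _), k3, Pi.smul_apply, smul_eq_mul]
    · rw [Pi.smul_apply, k4 w hw, smul_zero]
  · rw [normalDerivSum_smul c hu, hu.kirchhoff w hw, mul_zero]

lemma memDomain_zero : G.MemDomain 0 := by
  have hd : ∀ k, weakDeriv (G.edge k) (0 : L2 (G.edge k)) = 0 :=
    fun k => (hasWeakDeriv_zero _).weakDeriv_eq (G.isOpen_edge k)
  have hv : ∀ k, ∀ x ∈ closure (G.edge k), pointValue (G.edge k) (0 : L2 (G.edge k)) x = 0 :=
    fun k x hx => (isContRep_zero _).pointValue_eq (G.isOpen_edge k) hx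
  refine ⟨fun k => isC1H2_zero (G.isOpen_edge k), ⟨0, fun b => ?_, fun b => ?_, fun k => ?_,
    fun _ _ => rfl⟩, fun w _ => ?_⟩
  · exact hv _ _ (G.zero_mem_closure_edge _)
  · exact hv _ _ (G.len_mem_closure_edge _)
  · exact hv _ _ (G.zero_mem_closure_edge _)
  · have h0 : ∀ k, G.derivVal 0 k 0 = 0 := fun k => by
      rw [derivVal, PiLp.zero_apply, hd]
      exact hv _ _ (G.zero_mem_closure_edge _)
    have h1 : ∀ b, G.derivVal 0 (Sum.inl b) (G.len b) = 0 := fun b => by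
      rw [derivVal, PiLp.zero_apply, hd]
      exact hv _ _ (G.len_mem_closure_edge _)
    simp [normalDerivSum, h0, h1]

variable (G)

/-- The Hamiltonian `H u = (-u_k'')_k` on `L²` of the graph, with its domain. -/
def hamiltonian : G.L2Graph →ₗ.[ℂ] G.L2Graph where
  domain :=
    { carrier := {u | G.MemDomain u}
      add_mem' := fun hu hv => hu.add hv
      zero_mem' := memDomain_zero
      smul_mem' := fun c _ hu => hu.smul c }
  toFun :=
    { toFun := fun u => WithLp.toLp 2 fun k =>
        -weakDeriv (G.edge k) (weakDeriv (G.edge k) (u.1 k))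
      map_add' := by
        rintro ⟨u, hu : G.MemDomain u⟩ ⟨v, hv : G.MemDomain v⟩
        ext1 k
        have hk := G.isOpen_edge k
        change -weakDeriv _ (weakDeriv _ (u k + v k)) =
          -weakDeriv _ (weakDeriv _ (u k)) + -weakDeriv _ (weakDeriv _ (v k))
        rw [weakDeriv_add hk (hu.edgewise k).memH2.hasWeakDeriv
            (hv.edgewise k).memH2.hasWeakDeriv,
          weakDeriv_add hk ((hu.edgewise k).memH2.hasWeakDeriv' hk)
            ((hv.edgewise k).memH2.hasWeakDeriv' hk), neg_add]
      map_smul' := by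
        rintro c ⟨u, hu : G.MemDomain u⟩
        ext1 k
        have hk := G.isOpen_edge k
        change -weakDeriv _ (weakDeriv _ (c • u k)) = c • -weakDeriv _ (weakDeriv _ (u k))
        rw [weakDeriv_smul hk c (hu.edgewise k).memH2.hasWeakDeriv,
          weakDeriv_smul hk c ((hu.edgewise k).memH2.hasWeakDeriv' hk), smul_neg] }

/-- The Schrödinger group `t ↦ e^{-itH}`, the group generated by `-iH`. -/
def schrodingerGroup : ℝ → G.L2Graph →L[ℂ] G.L2Graph :=
  expGroup ((-Complex.I) • G.hamiltonian)

end MetricGraph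

end

/-! The generation statement is Stone's theorem, proved by way of the resolvent `K = (H + 1)⁻¹`. Let
the form domain be the set of pairs `(v, v')` with `v` in `H¹` edgewise, continuous on the graph and
zero at exterior vertices. It is closed in `L² × L²`, because values at edge ends are inner products
in `H¹`. Projecting `(f, 0)` orthogonally onto it yields a pair `(u, u')` with `⟨v, u⟩ + ⟨v', u'⟩ =
⟨v, f⟩` for every `(v, v')` in it, which is the weak form of `-u'' + u = f`. So `K f = u` is a
bounded operator, self-adjoint as the compression of a projection. Test functions inside one edge
give the equation, and functions equal to `1` at one vertex and `0` at the others give the Kirchhoff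
conditions (`resolvent_spec`). Green's formula gives the converse (`resolvent_sub_edgeDeriv`). Hence
`K` is injective and the graph of `-iH` is `{(K z, -i(z - K z))}`.

For any bounded injective self-adjoint `K` the group comes from the continuous functional calculus
(`exists_isC0GroupGeneratedBy`). The symbol `exp (-it(1/k - 1))` is singular at `k = 0`, but `k`
times it is continuous on the real axis and has modulus `|k|`. This defines `e^{-itH} K`, hence an
isometry on the dense range of `K`, which extends to the whole space.

For the conservation law, `∂ₜu = iu''` on each edge, so `i d/dt ‖u_b‖²` equals `-(⟨u_b, u_b''⟩ -
⟨u_b'', u_b⟩)`, a boundary term on a bounded edge. Continuity and the Kirchhoff or vanishing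
conditions cancel the boundary terms over all edge ends, so those of the bounded edges are opposite
to those of the half-lines (`MemDomain.sum_inner_sub_inner`). -/

noncomputable section

namespace QuantumGraph

/-! ### Stone's theorem from a bounded injective self-adjoint resolvent. -/

section AbstractGroup

/-- The symbol `k ↦ k exp (-i t (1/k - 1))` of `e^{-itH} K`, where `K = (H + 1)⁻¹`. -/
def groupSymbol (t : ℝ) (k : ℂ) : ℂ :=
  k * Complex.exp ((-(t * (k.re⁻¹ - 1)) : ℝ) * Complex.I)

lemma norm_groupSymbol (t : ℝ) (k : ℂ) : ‖groupSymbol t k‖ = ‖k‖ := by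
  rw [groupSymbol, norm_mul, Complex.norm_exp_ofReal_mul_I, mul_one]

/-- On the real axis the phase is singular only at `0`, where the factor `k` forces the limit `0`.
Restriction to the real axis matters: the phase also oscillates near nonreal points of the imaginary
axis. -/
lemma continuousOn_groupSymbol (t : ℝ) : ContinuousOn (groupSymbol t) {k : ℂ | k.im = 0} := by
  intro k hk
  by_cases h : k = 0
  · subst h
    have h0 : groupSymbol t 0 = 0 := by simp [groupSymbol]
    rw [ContinuousWithinAt, h0]
    refine squeeze_zero_norm (fun x => (norm_groupSymbol t x).le) ?_
    have : Tendsto (fun x : ℂ => ‖x‖) (𝓝 0) (𝓝 ‖(0 : ℂ)‖) := continuous_norm.tendsto 0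
    rw [norm_zero] at this
    exact this.mono_left nhdsWithin_le_nhds
  · have hre : k.re ≠ 0 := fun h' => h (Complex.ext h' hk)
    refine ContinuousAt.continuousWithinAt ?_
    unfold groupSymbol
    have : ContinuousAt (fun x : ℂ => x.re⁻¹) k :=
      Complex.continuous_re.continuousAt.inv₀ hre
    fun_prop

lemma norm_exp_ofReal_mul_I_sub_one_sub_le (θ : ℝ) :
    ‖Complex.exp (θ * Complex.I) - 1 - θ * Complex.I‖ ≤ 3 * θ ^ 2 := by
  have hn : ‖(θ : ℂ) * Complex.I‖ = |θ| := by simp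
  by_cases h : |θ| ≤ 1
  -- For `|θ| ≤ 1` the quadratic Taylor bound applies; for `|θ| > 1` the crude bound `2 + |θ| ≤ 3
  -- θ²` accounts for the constant `3`.
  · have := Complex.norm_exp_sub_one_sub_id_le (x := θ * Complex.I) (by rwa [hn])
    rw [hn, sq_abs] at this
    nlinarith [sq_nonneg θ]
  · push Not at h
    have h1 := norm_sub_le (Complex.exp (θ * Complex.I) - 1) (θ * Complex.I)
    have h2 := norm_sub_le (Complex.exp (θ * Complex.I)) 1
    rw [Complex.norm_exp_ofReal_mul_I, norm_one] at h2
    rw [hn] at h1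
    nlinarith [sq_abs θ, abs_nonneg θ]

/-- The phases differ by `(t - s)(1/k - 1)`, and the prefactor `k` turns this into `(t - s)(1 - k)`,
which is bounded on the spectrum. -/
lemma norm_groupSymbol_sub_le (s t : ℝ) {k : ℂ} (hk : k.im = 0) :
    ‖groupSymbol t k - groupSymbol s k‖ ≤ |t - s| * ‖1 - k‖ := by
  obtain ⟨r, rfl⟩ : ∃ r : ℝ, k = r := ⟨k.re, Complex.ext rfl hk⟩
  by_cases h : r = 0
  · subst h
    simp [groupSymbol]
  have e : groupSymbol t r - groupSymbol s r = r * Complex.exp ((-(s * (r⁻¹ - 1)) : ℝ) * Complex.I)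
      * (Complex.exp (Complex.I * (-((t - s) * (r⁻¹ - 1)) : ℝ)) - 1) := by
    rw [mul_sub, mul_assoc, ← Complex.exp_add]
    simp only [groupSymbol, Complex.ofReal_re, mul_one]
    congr 3
    push_cast
    ring
  rw [e, norm_mul, norm_mul, Complex.norm_exp_ofReal_mul_I, mul_one]
  calc _ ≤ ‖(r : ℂ)‖ * ‖-((t - s) * (r⁻¹ - 1))‖ := by
        gcongr
        exact Real.norm_exp_I_mul_ofReal_sub_one_le
    _ = |t - s| * ‖(1 : ℂ) - r‖ := by
        rw [← Complex.ofReal_one, ← Complex.ofReal_sub, Complex.norm_real, Complex.norm_real,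
          norm_neg, norm_mul, Real.norm_eq_abs (t - s), mul_left_comm, ← norm_mul]
        congr 2
        field_simp

/-- The second-order remainder is of size `t²(1/k - 1)²`; it takes a second factor `k` to remove the
singularity. -/
lemma norm_groupSymbol_taylor_le (t : ℝ) {k : ℂ} (hk : k.im = 0) :
    ‖k * (groupSymbol t k - k + t * Complex.I * (1 - k))‖ ≤ 3 * t ^ 2 * ‖1 - k‖ ^ 2 := by
  obtain ⟨r, rfl⟩ : ∃ r : ℝ, k = r := ⟨k.re, Complex.ext rfl hk⟩
  by_cases h : r = 0
  · subst h
    simp [groupSymbol]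
    positivity
  have hr : (r : ℂ) ≠ 0 := by exact_mod_cast h
  set θ : ℝ := -(t * (r⁻¹ - 1)) with hθ
  have e : (r : ℂ) * (groupSymbol t r - r + t * Complex.I * (1 - r)) =
      r ^ 2 * (Complex.exp (θ * Complex.I) - 1 - θ * Complex.I) := by
    simp only [groupSymbol, Complex.ofReal_re, ← hθ]
    have : (θ : ℂ) = -(t * ((r : ℂ)⁻¹ - 1)) := by rw [hθ]; push_cast; ring
    linear_combination (r : ℂ) ^ 2 * Complex.I * this -
      r * t * Complex.I * (mul_inv_cancel₀ hr)
  rw [e, norm_mul, norm_pow, Complex.norm_real, Real.norm_eq_abs, sq_abs]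
  calc _ ≤ r ^ 2 * (3 * θ ^ 2) := by
        gcongr
        exact norm_exp_ofReal_mul_I_sub_one_sub_le θ
    _ = 3 * t ^ 2 * ‖(1 : ℂ) - r‖ ^ 2 := by
        rw [← Complex.ofReal_one, ← Complex.ofReal_sub, Complex.norm_real, Real.norm_eq_abs, sq_abs,
          hθ]
        field_simp

variable {E : Type*} [NormedAddCommGroup E] [InnerProductSpace ℂ E] [CompleteSpace E]
  {K : E →L[ℂ] E}

/-- The orthogonal complement of the range is the kernel of the adjoint, here `K` itself. -/
lemma denseRange_of_isSelfAdjoint (hK : IsSelfAdjoint K) (hinj : Function.Injective K) :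
    DenseRange K := by
  have h1 : (LinearMap.range (K : E →ₗ[ℂ] E))ᗮ = ⊥ := by
    rw [ContinuousLinearMap.orthogonal_range, (ContinuousLinearMap.isSelfAdjoint_iff' ).1 hK]
    exact LinearMap.ker_eq_bot.2 hinj
  have h2 := Submodule.topologicalClosure_eq_top_iff.2 h1
  have h3 := Submodule.dense_iff_topologicalClosure_eq_top.2 h2
  exact h3

lemma continuousOn_groupSymbol_spectrum (hK : IsSelfAdjoint K) (t : ℝ) :
    ContinuousOn (groupSymbol t) (spectrum ℂ K) :=
  (continuousOn_groupSymbol t).mono fun _ hk => hK.im_eq_zero_of_mem_spectrum hk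

lemma norm_cfc_le_of_real (hK : IsSelfAdjoint K) {f g : ℂ → ℂ} {c : ℝ} (hc : 0 ≤ c)
    (hg : ContinuousOn g (spectrum ℂ K))
    (h : ∀ k : ℂ, k.im = 0 → ‖f k‖ ≤ c * ‖g k‖) : ‖cfc f K‖ ≤ c * ‖cfc g K‖ := by
  refine norm_cfc_le (by positivity) fun k hk => ?_
  refine (h k (hK.im_eq_zero_of_mem_spectrum hk)).trans ?_
  gcongr
  exact norm_apply_le_norm_cfc g K hk hg hK.isStarNormal

/-- `e^{-itH} K`, where `K = (H + 1)⁻¹`. -/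
def groupMul (K : E →L[ℂ] E) (t : ℝ) : E →L[ℂ] E := cfc (groupSymbol t) K

lemma groupMul_zero (hK : IsSelfAdjoint K) : groupMul K 0 = K := by
  have : groupSymbol 0 = id := by
    ext k
    simp [groupSymbol]
  rw [groupMul, this, cfc_id ℂ K hK.isStarNormal]

/-- The group law for `e^{-itH}` multiplied by `K²`; the surplus `K` is cancelled later by
injectivity. -/
lemma groupMul_mul (hK : IsSelfAdjoint K) (s t : ℝ) :
    groupMul K s * groupMul K t = K * groupMul K (s + t) := by
  have hc := continuousOn_groupSymbol_spectrum hK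
  have h1 : K * groupMul K (s + t) = cfc (id : ℂ → ℂ) K * groupMul K (s + t) := by
    rw [cfc_id ℂ K hK.isStarNormal]
  rw [h1, groupMul, groupMul, groupMul, ← cfc_mul _ _ K (hc s) (hc t),
    ← cfc_mul _ _ K continuousOn_id (hc (s + t))]
  congr 1
  ext k
  simp only [groupSymbol, id]
  rw [mul_mul_mul_comm, ← Complex.exp_add, mul_assoc]
  congr 3
  push_cast
  ring

lemma groupMul_comm (hK : IsSelfAdjoint K) (t : ℝ) : groupMul K t * K = K * groupMul K t := by
  have := groupMul_mul hK t 0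
  rwa [groupMul_zero hK, add_zero] at this

/-- The symbol has the same modulus as `k`, so `S* S = K* K` for `S = groupMul K t`. -/
lemma norm_groupMul_apply (hK : IsSelfAdjoint K) (t : ℝ) (z : E) :
    ‖groupMul K t z‖ = ‖K z‖ := by
  have hc := continuousOn_groupSymbol_spectrum hK t
  have h1 : star (groupMul K t) * groupMul K t = star K * K := by
    have h1 : star K * K = star (cfc (id : ℂ → ℂ) K) * cfc (id : ℂ → ℂ) K := by
      rw [cfc_id ℂ K hK.isStarNormal]
    rw [h1, groupMul, ← cfc_star, ← cfc_mul _ _ K hc.star hc, ← cfc_star, ← cfc_mul _ _ K continuousOn_id.star continuousOn_id]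
    refine cfc_congr fun k _ => ?_
    simp only [groupSymbol, id, RCLike.star_def, map_mul]
    rw [mul_mul_mul_comm, Complex.conj_mul', Complex.conj_mul', Complex.norm_exp_ofReal_mul_I]
    simp
  have h2 : ∀ S : E →L[ℂ] E, ‖S z‖ ^ 2 = RCLike.re (inner ℂ ((star S * S) z) z) := fun S => by
    rw [ContinuousLinearMap.star_eq_adjoint]
    exact S.apply_norm_sq_eq_inner_adjoint_left z
  rw [← sq_eq_sq₀ (norm_nonneg _) (norm_nonneg _), h2, h1, ← h2]

/-- The assignment `K z ↦ groupMul K t z` is well defined by injectivity of `K` and isometric on its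
dense range, so it extends by continuity. -/
lemma exists_group (hK : IsSelfAdjoint K) (hinj : Function.Injective K) :
    ∃ T : ℝ → E →L[ℂ] E, (∀ t z, T t (K z) = groupMul K t z) ∧ ∀ t x, ‖T t x‖ = ‖x‖ := by
  have hd := denseRange_of_isSelfAdjoint hK hinj
  have key : ∀ t : ℝ, ∃ S : E →L[ℂ] E, (∀ z, S (K z) = groupMul K t z) ∧ ∀ x, ‖S x‖ = ‖x‖ := by
    intro t
    let p := LinearMap.range (K : E →ₗ[ℂ] E)
    let e : E ≃ₗ[ℂ] p := LinearEquiv.ofInjective (K : E →ₗ[ℂ] E) hinj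
    have he : ∀ y : p, K (e.symm y) = y := fun y =>
      congrArg Subtype.val (e.apply_symm_apply y)
    let f : p →ₗᵢ[ℂ] E :=
      { toLinearMap := (groupMul K t : E →ₗ[ℂ] E) ∘ₗ (e.symm : p →ₗ[ℂ] E)
        norm_map' := fun y => by
          change ‖groupMul K t (e.symm y)‖ = ‖(y : E)‖
          rw [norm_groupMul_apply hK, he] }
    have hdp : DenseRange p.subtypeL := by
      change Dense (Set.range (Subtype.val : p → E))
      rw [Subtype.range_coe]
      exact hd
    have hui : IsUniformInducing p.subtypeL := isUniformInducing_val _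
    have hext : ∀ z, (f.toContinuousLinearMap.extend p.subtypeL) (K z) = groupMul K t z := by
      intro z
      have h1 := ContinuousLinearMap.extend_eq f.toContinuousLinearMap hdp hui (e z)
      have h2 : f.toContinuousLinearMap (e z) = groupMul K t z := by
        change groupMul K t (e.symm (e z)) = _
        rw [e.symm_apply_apply]
      exact h1.trans h2
    refine ⟨f.toContinuousLinearMap.extend p.subtypeL, hext, fun x => ?_⟩
    refine hd.induction_on (p := fun x => ‖(f.toContinuousLinearMap.extend p.subtypeL) x‖ = ‖x‖) x
      (isClosed_eq (by fun_prop) (by fun_prop)) fun z => ?_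
    rw [hext, norm_groupMul_apply hK]
  choose T h1 h2 using key
  exact ⟨T, h1, h2⟩

lemma norm_groupMul_sub_le (hK : IsSelfAdjoint K) (s t : ℝ) :
    ‖groupMul K t - groupMul K s‖ ≤ |t - s| * ‖1 - K‖ := by
  have hc := continuousOn_groupSymbol_spectrum hK
  have h1 : cfc (fun k : ℂ => 1 - k) K = 1 - K := by
    rw [cfc_sub (fun _ => (1 : ℂ)) (fun k => k) K, cfc_const_one ℂ K hK.isStarNormal,
      cfc_id' ℂ K hK.isStarNormal]
  rw [groupMul, groupMul, ← cfc_sub _ _ K (hc t) (hc s), ← h1]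
  exact norm_cfc_le_of_real hK (abs_nonneg _) (by fun_prop)
    fun k hk => norm_groupSymbol_sub_le s t hk

lemma norm_groupMul_taylor_le (hK : IsSelfAdjoint K) (t : ℝ) :
    ‖K * (groupMul K t - K + (t * Complex.I) • (1 - K))‖ ≤ 3 * t ^ 2 * ‖(1 - K) ^ 2‖ := by
  have hc := continuousOn_groupSymbol_spectrum hK t
  have hn := hK.isStarNormal
  have h1 : cfc (fun k : ℂ => 1 - k) K = 1 - K := by
    rw [cfc_sub (fun _ => (1 : ℂ)) (fun k => k) K, cfc_const_one ℂ K hn, cfc_id' ℂ K hn]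
  have h2 : cfc (fun k : ℂ => (1 - k) ^ 2) K = (1 - K) ^ 2 := by
    rw [cfc_pow (fun k : ℂ => 1 - k) 2 K, h1]
  have h3 : cfc (fun k : ℂ => k * (groupSymbol t k - k + t * Complex.I * (1 - k))) K =
      K * (groupMul K t - K + (t * Complex.I) • (1 - K)) := by
    rw [cfc_mul (fun k => k) (fun k => groupSymbol t k - k + t * Complex.I * (1 - k)) K
        continuousOn_id ((hc.sub continuousOn_id).add (by fun_prop)),
      cfc_add K (fun k => groupSymbol t k - k) (fun k => t * Complex.I * (1 - k))
        (hc.sub continuousOn_id) (by fun_prop),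
      cfc_sub (groupSymbol t) (fun k => k) K hc continuousOn_id,
      cfc_const_mul (t * Complex.I) (fun k : ℂ => 1 - k) K, h1, cfc_id' ℂ K hn, groupMul]
  rw [← h2, ← h3]
  refine norm_cfc_le_of_real hK (by positivity) (by fun_prop) fun k hk => ?_
  rw [norm_pow]
  exact norm_groupSymbol_taylor_le t hk

omit [CompleteSpace E] in
/-- Strong convergence of a norm-bounded family of operators may be checked on a dense range. -/
lemma tendsto_apply_of_denseRange {ι : Type*} {l : Filter ι} {D : ι → E →L[ℂ] E}
    {L : E →L[ℂ] E} {C : ℝ} (hD : ∀ i, ‖D i‖ ≤ C) (hd : DenseRange K)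
    (h : ∀ z, Tendsto (fun i => D i (K z)) l (𝓝 (L (K z)))) (x : E) :
    Tendsto (fun i => D i x) l (𝓝 (L x)) := by
  rcases l.eq_or_neBot with rfl | hne
  · exact tendsto_bot
  have hC : 0 ≤ C := by
    obtain ⟨i⟩ := hne.nonempty
    exact (norm_nonneg _).trans (hD i)
  rw [Metric.tendsto_nhds]
  intro ε hε
  set M := C + ‖L‖ + 1 with hM
  have hMpos : 0 < M := by positivity
  obtain ⟨z, hz⟩ := Metric.denseRange_iff.1 hd x (ε / (2 * M)) (by positivity)
  rw [dist_eq_norm] at hz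
  filter_upwards [Metric.tendsto_nhds.1 (h z) (ε / 2) (by positivity)] with i hi
  rw [dist_eq_norm] at hi ⊢
  have e : D i x - L x = D i (x - K z) + (D i (K z) - L (K z)) - L (x - K z) := by
    simp only [map_sub]; abel
  have h1 : ‖D i (x - K z)‖ ≤ C * ‖x - K z‖ := (D i).le_of_opNorm_le (hD i) _
  have h2 : ‖L (x - K z)‖ ≤ ‖L‖ * ‖x - K z‖ := L.le_opNorm _
  have h3 : (C + ‖L‖) * ‖x - K z‖ ≤ M * ‖x - K z‖ := by
    gcongr; linarith
  have h4 : M * ‖x - K z‖ < ε / 2 := by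
    calc M * ‖x - K z‖ < M * (ε / (2 * M)) := by gcongr
      _ = ε / 2 := by field_simp
  rw [e]
  have h5 := norm_sub_le (D i (x - K z) + (D i (K z) - L (K z))) (L (x - K z))
  have h6 := norm_add_le (D i (x - K z)) (D i (K z) - L (K z))
  nlinarith

lemma tendsto_groupMul (hK : IsSelfAdjoint K) (hd : DenseRange K) (z : E) :
    Tendsto (fun t : ℝ => (t : ℂ)⁻¹ • (groupMul K t z - K z)) (𝓝[≠] 0)
      (𝓝 (-Complex.I • (z - K z))) := by
  let D : ℝ → E →L[ℂ] E := fun t => (t : ℂ)⁻¹ • (groupMul K t - K)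
  have hD : ∀ t, ‖D t‖ ≤ ‖1 - K‖ := by
    intro t
    by_cases ht : t = 0
    -- At `t = 0` the inverse is `0` by convention, so the bound on `D t` holds for every `t`.
    · simp [D, ht]
    have h1 := norm_groupMul_sub_le hK 0 t
    rw [groupMul_zero hK, sub_zero] at h1
    rw [norm_smul, norm_inv, Complex.norm_real, Real.norm_eq_abs, inv_mul_le_iff₀ (abs_pos.2 ht)]
    exact h1
  -- The quotients are uniformly bounded, so convergence need only be checked on vectors `K w`.
  -- There the extra `K` makes the Taylor bound available, with an error of order `|t|`.
  refine tendsto_apply_of_denseRange (D := D) (L := -Complex.I • (1 - K)) hD hd (fun w => ?_) z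
  rw [tendsto_iff_norm_sub_tendsto_zero]
  have hb : Tendsto (fun t : ℝ => |t| * (3 * ‖(1 - K) ^ 2‖ * ‖w‖)) (𝓝[≠] 0) (𝓝 0) := by
    have : Tendsto (fun t : ℝ => |t| * (3 * ‖(1 - K) ^ 2‖ * ‖w‖)) (𝓝 0)
        (𝓝 (|(0 : ℝ)| * (3 * ‖(1 - K) ^ 2‖ * ‖w‖))) := Continuous.tendsto (by fun_prop) 0
    rw [abs_zero, zero_mul] at this
    exact this.mono_left nhdsWithin_le_nhds
  refine squeeze_zero' (Eventually.of_forall fun _ => norm_nonneg _) ?_ hb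
  filter_upwards [self_mem_nhdsWithin] with t (ht : t ≠ 0)
  have htc : (t : ℂ) ≠ 0 := by exact_mod_cast ht
  have e : D t (K w) - (-Complex.I • (1 - K)) (K w) =
      (t : ℂ)⁻¹ • (K * (groupMul K t - K + (t * Complex.I) • (1 - K))) w := by
    have h1 : groupMul K t (K w) = K (groupMul K t w) :=
      congrArg (fun S : E →L[ℂ] E => S w) (groupMul_comm hK t)
    have h2 : (t : ℂ)⁻¹ * (t * Complex.I) = Complex.I := by field_simp
    simp only [D, smul_apply, sub_apply, add_apply, mul_apply_eq_comp,
      one_apply_eq_self, map_add, map_sub, map_smul, smul_add, smul_sub, smul_smul, h1,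
      h2, neg_smul, neg_apply]
    abel
  rw [e, norm_smul, norm_inv, Complex.norm_real, Real.norm_eq_abs, inv_mul_le_iff₀ (abs_pos.2 ht)]
  refine ((K * (groupMul K t - K + (t * Complex.I) • (1 - K))).le_of_opNorm_le
    (norm_groupMul_taylor_le hK t) w).trans (le_of_eq ?_)
  rw [← sq_abs t]
  ring

/-- If `K` is a bounded injective self-adjoint operator, then `-iH`, where `H = K⁻¹ - 1`, generates
a strongly continuous group. -/
theorem exists_isC0GroupGeneratedBy (hK : IsSelfAdjoint K) (hinj : Function.Injective K)
    {A : E →ₗ.[ℂ] E}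
    (hA : ∀ x y, (x, y) ∈ A.graph ↔ ∃ z, x = K z ∧ y = -Complex.I • (z - K z)) :
    ∃ T, IsC0GroupGeneratedBy A T := by
  have hd := denseRange_of_isSelfAdjoint hK hinj
  obtain ⟨T, hT, hn⟩ := exists_group hK hinj
  have hext : ∀ S S' : E →L[ℂ] E, (∀ z, S (K z) = S' (K z)) → S = S' := fun S S' h =>
    ContinuousLinearMap.coeFn_injective (hd.equalizer S.continuous S'.continuous (funext h))
  have hcomm : ∀ t x, T t (K x) = K (T t x) := by
    intro t x
    refine congrArg (fun S : E →L[ℂ] E => S x) (hext (T t * K) (K * T t) fun z => ?_)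
    simp only [mul_apply_eq_comp, hT]
    exact congrArg (fun S : E →L[ℂ] E => S z) (groupMul_comm hK t)
  have hcont : ∀ z, Continuous fun t => groupMul K t z := by
    intro z
    have : LipschitzWith (‖1 - K‖ * ‖z‖).toNNReal fun t => groupMul K t z := by
      refine LipschitzWith.of_dist_le' fun t s => ?_
      rw [dist_eq_norm, Real.dist_eq, ← sub_apply]
      refine ((groupMul K t - groupMul K s).le_of_opNorm_le
        (norm_groupMul_sub_le hK s t) z).trans (le_of_eq (by ring))
    exact this.continuous
  refine ⟨T, ⟨?_, fun s t => ?_, fun x => ?_, fun x y => ?_⟩⟩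
  · refine hext _ _ fun z => ?_
    rw [hT, groupMul_zero hK, one_apply_eq_self]
  · refine hext _ _ fun z => ?_
    rw [mul_apply_eq_comp, hT, hT]
    -- Applying `K` makes both sides instances of the product formula for `groupMul`.
    refine hinj ?_
    rw [← hcomm, hT]
    exact (congrArg (fun S : E →L[ℂ] E => S z) (groupMul_mul hK s t)).symm
  · rw [continuous_iff_continuousAt]
    intro t
    refine tendsto_apply_of_denseRange (C := 1) (fun s => ?_) hd (fun z => ?_) x
    · exact ContinuousLinearMap.opNorm_le_bound _ zero_le_one fun x => by rw [hn, one_mul]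
    · simp only [hT]
      exact (hcont z).tendsto t
  · have hgen : ∀ z, Tendsto (fun t : ℝ => (t : ℂ)⁻¹ • (T t (K z) - K z)) (𝓝[≠] 0)
        (𝓝 (-Complex.I • (z - K z))) := fun z => by
      simp only [hT]
      exact tendsto_groupMul hK hd z
    rw [hA]
    constructor
    · rintro ⟨z, rfl, rfl⟩
      exact hgen z
    · intro h
      -- No vector outside the range of `K` is differentiable along the group: applying `K` to the
      -- quotients gives `K y = -i(x - K x)`, which can be solved for `x`.
      have h1 := (K.continuous.tendsto y).comp h
      have h2 : K y = -Complex.I • (x - K x) := by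
        refine tendsto_nhds_unique h1 ((hgen x).congr fun t => ?_)
        simp only [Function.comp_apply, map_smul, map_sub, hcomm]
      -- The witness is `(H + 1) x` with `H x = i y`.
      refine ⟨x + Complex.I • y, ?_, ?_⟩
      · rw [map_add, map_smul, h2, smul_smul]
        simp
      · have h3 : K (x + Complex.I • y) = x := by
          rw [map_add, map_smul, h2, smul_smul]
          simp
        rw [h3, add_sub_cancel_left, smul_smul]
        simp

end AbstractGroup

/-! ### Locally absolutely continuous functions and integration by parts. -/

section Primitives

/-- `F` is a locally absolutely continuous function on the line with derivative `f`. -/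
structure IsPrimitive (F f : ℝ → ℂ) : Prop where
  locallyIntegrable : LocallyIntegrable f volume
  integral_eq : ∀ a b, ∫ t in a..b, f t = F b - F a

lemma isPrimitive_of_hasDerivAt {F f : ℝ → ℂ} (hF : ∀ x, HasDerivAt F (f x) x)
    (hf : Continuous f) : IsPrimitive F f :=
  ⟨hf.locallyIntegrable, fun a b =>
    intervalIntegral.integral_eq_sub_of_hasDerivAt (fun x _ => hF x) (hf.intervalIntegrable a b)⟩

lemma intervalIntegrable_of_locallyIntegrable {f : ℝ → ℂ} (hf : LocallyIntegrable f volume)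
    (a b : ℝ) : IntervalIntegrable f volume a b :=
  (hf.integrableOn_isCompact isCompact_uIcc).intervalIntegrable

lemma isPrimitive_integral {f : ℝ → ℂ} (hf : LocallyIntegrable f volume) (c : ℂ) :
    IsPrimitive (fun x => c + ∫ t in (0 : ℝ)..x, f t) f := by
  refine ⟨hf, fun a b => ?_⟩
  rw [add_sub_add_left_eq_sub, intervalIntegral.integral_interval_sub_left] <;>
  exact intervalIntegrable_of_locallyIntegrable hf _ _

namespace IsPrimitive

variable {F f G g : ℝ → ℂ}

lemma intervalIntegrable (h : IsPrimitive F f) (a b : ℝ) : IntervalIntegrable f volume a b :=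
  intervalIntegrable_of_locallyIntegrable h.locallyIntegrable a b

lemma eq_add_integral (h : IsPrimitive F f) (a : ℝ) :
    F = fun x => F a + ∫ t in a..x, f t := by
  ext x
  rw [h.integral_eq]
  ring

lemma continuous (h : IsPrimitive F f) : Continuous F := by
  rw [h.eq_add_integral 0]
  exact continuous_const.add (intervalIntegral.continuous_primitive h.intervalIntegrable 0)

lemma conj (h : IsPrimitive F f) :
    IsPrimitive (fun x => (starRingEnd ℂ) (F x)) fun x => (starRingEnd ℂ) (f x) := by
  refine ⟨fun x => ?_, fun a b => ?_⟩
  · obtain ⟨s, hs, hi⟩ := h.locallyIntegrable x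
    exact ⟨s, hs, (Complex.conjLIE.toContinuousLinearEquiv.integrable_comp_iff).2 hi⟩
  · rw [← map_sub, ← h.integral_eq]
    exact Complex.conjLIE.toContinuousLinearEquiv.toContinuousLinearMap.intervalIntegral_comp_comm
      (h.intervalIntegrable a b)

lemma ae_hasDerivAt (h : IsPrimitive F f) : ∀ᵐ x, HasDerivAt F (f x) x := by
  filter_upwards [LocallyIntegrable.ae_hasDerivAt_integral h.locallyIntegrable] with x hx
  rw [h.eq_add_integral 0]
  exact (hx 0).const_add _

lemma absolutelyContinuousOnInterval (h : IsPrimitive F f) (a b : ℝ) :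
    AbsolutelyContinuousOnInterval F a b := by
  have hi := h.intervalIntegrable
  have hre : ∀ a b, IntervalIntegrable (fun t => (f t).re) volume a b := fun a b =>
    ⟨(hi a b).1.re, (hi a b).2.re⟩
  have him : ∀ a b, IntervalIntegrable (fun t => (f t).im) volume a b := fun a b =>
    ⟨(hi a b).1.im, (hi a b).2.im⟩
  have hconst : ∀ c : ℂ, AbsolutelyContinuousOnInterval (fun _ => c) a b := fun c =>
    (LipschitzOnWith.absolutelyContinuousOnInterval (K := 0)
      (LipschitzWith.const c).lipschitzOnWith)
  -- Real and imaginary parts are treated separately as real indefinite integrals, then recombined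
  -- with the constants `1` and `i`.
  have h1 := ((hre a b).absolutelyContinuousOnInterval_intervalIntegral
    (c := a) Set.left_mem_uIcc).smul (hconst 1)
  have h2 := ((him a b).absolutelyContinuousOnInterval_intervalIntegral
    (c := a) Set.left_mem_uIcc).smul (hconst Complex.I)
  have h3 := (hconst (F a)).add (h1.add h2)
  suffices hfun : F = (fun _ => F a) + ((fun x => ∫ v in a..x, (f v).re) • (fun _ => (1 : ℂ)) +
      (fun x => ∫ v in a..x, (f v).im) • fun _ => Complex.I) by
    rw [hfun]
    exact h3
  funext x
  have h4 := congrFun (h.eq_add_integral a) x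
  rw [h4]
  simp only [Pi.add_apply, Pi.smul_apply', Complex.real_smul, mul_one]
  congr 1
  have h5 : (∫ t in a..x, f t) = ∫ t in a..x, (((f t).re : ℂ) + (f t).im * Complex.I) := by
    simp only [Complex.re_add_im]
  rw [h5, intervalIntegral.integral_add, intervalIntegral.integral_mul_const,
    intervalIntegral.integral_ofReal, intervalIntegral.integral_ofReal]
  · exact ⟨(hre a x).1.ofReal, (hre a x).2.ofReal⟩
  · exact IntervalIntegrable.mul_const ⟨(him a x).1.ofReal, (him a x).2.ofReal⟩ _

/-- `F G` minus the integral of the expected derivative is absolutely continuous with derivative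
zero almost everywhere, hence constant. -/
lemma mul (hF : IsPrimitive F f) (hG : IsPrimitive G g) :
    IsPrimitive (fun x => F x * G x) fun x => f x * G x + F x * g x := by
  have hloc : LocallyIntegrable (fun x => f x * G x + F x * g x) volume := by
    refine LocallyIntegrable.add ?_ ?_
    · have := hF.locallyIntegrable.locallyIntegrableOn Set.univ
      rw [← locallyIntegrableOn_univ]
      exact this.mul_continuousOn hG.continuous.continuousOn
        (by exact isOpen_univ.isLocallyClosed)
    · have := hG.locallyIntegrable.locallyIntegrableOn Set.univ
      rw [← locallyIntegrableOn_univ]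
      exact this.continuousOn_mul hF.continuous.continuousOn
        (by exact isOpen_univ.isLocallyClosed)
  refine ⟨hloc, fun a b => ?_⟩
  have hP := isPrimitive_integral hloc 0
  have h1 : AbsolutelyContinuousOnInterval (fun x => F x * G x) a b :=
    (hF.absolutelyContinuousOnInterval a b).smul (hG.absolutelyContinuousOnInterval a b)
  have h2 := h1.sub (hP.absolutelyContinuousOnInterval a b)
  obtain ⟨C, hC⟩ := h2.const_of_ae_hasDerivAt_zero (by
    filter_upwards [hF.ae_hasDerivAt, hG.ae_hasDerivAt, hP.ae_hasDerivAt] with x hx1 hx2 hx3 _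
    have := (hx1.mul hx2).sub hx3
    rwa [sub_self] at this)
  have ha := hC a Set.left_mem_uIcc
  have hb := hC b Set.right_mem_uIcc
  rw [hP.integral_eq]
  simp only [Pi.sub_apply] at ha hb
  linear_combination ha - hb

/-- Integration by parts against a test function. -/
lemma integral_deriv_smul (hF : IsPrimitive F f) {Ω : Set ℝ} {φ : ℝ → ℝ}
    (hφ : ContDiff ℝ (⊤ : ℕ∞) φ) (hc : HasCompactSupport φ) (hs : tsupport φ ⊆ Ω) :
    ∫ x in Ω, deriv φ x • F x = -∫ x in Ω, φ x • f x := by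
  have hs' : ∀ x, x ∉ Ω → φ x = 0 := fun x hx =>
    image_eq_zero_of_notMem_tsupport fun hh => hx (hs hh)
  have hds : ∀ x, x ∉ Ω → deriv φ x = 0 := fun x hx =>
    image_eq_zero_of_notMem_tsupport fun hh => hx (hs (tsupport_deriv_subset hh))
  rw [setIntegral_eq_integral_of_forall_compl_eq_zero fun x hx => by rw [hds x hx, zero_smul],
    setIntegral_eq_integral_of_forall_compl_eq_zero fun x hx => by rw [hs' x hx, zero_smul]]
  -- With the support of `φ` inside `(-R, R)`, the product rule on `[-R, R]` has no boundary terms.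
  obtain ⟨R, hR⟩ := hc.isCompact.isBounded.subset_ball 0
  have hsub : ∀ {H : ℝ → ℂ}, (∀ x, x ∉ tsupport φ → H x = 0) →
      Function.support H ⊆ Set.Ioc (-R) R := by
    intro H h0 x hx
    by_contra hcon
    refine hx (h0 x fun hx' => hcon ?_)
    have := hR hx'
    rw [mem_ball_zero_iff, Real.norm_eq_abs, abs_lt] at this
    exact ⟨this.1, this.2.le⟩
  have hdφ : ∀ x, HasDerivAt (fun x => (φ x : ℂ)) ((deriv φ x : ℝ) : ℂ) x := fun x =>
    ((hφ.differentiable (by simp)).differentiableAt.hasDerivAt).ofReal_comp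
  have hdc : Continuous (deriv φ) := hφ.continuous_deriv (by simp)
  have hP := isPrimitive_of_hasDerivAt hdφ (Complex.continuous_ofReal.comp hdc)
  have key := (hP.mul hF).integral_eq (-R) R
  have e : ∀ y, y ∉ tsupport φ → φ y = 0 := fun y hy => image_eq_zero_of_notMem_tsupport hy
  have hbd : ∀ y, R ≤ |y| → φ y = 0 := fun y hy => e y fun hy' => by
    have := hR hy'
    rw [mem_ball_zero_iff, Real.norm_eq_abs] at this
    linarith
  rw [hbd R (le_abs_self R), hbd (-R) (by rw [abs_neg]; exact le_abs_self R),
    intervalIntegral.integral_add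
      ((hP.intervalIntegrable _ _).mul_continuousOn hF.continuous.continuousOn)
      ((hF.intervalIntegrable _ _).continuousOn_mul hP.continuous.continuousOn)] at key
  simp only [Complex.ofReal_zero, zero_mul, sub_self] at key
  rw [intervalIntegral.integral_eq_integral_of_support_subset (hsub fun x hx => by
      simp [image_eq_zero_of_notMem_tsupport fun hh => hx (tsupport_deriv_subset hh)]),
    intervalIntegral.integral_eq_integral_of_support_subset (hsub fun x hx => by
      simp [e x hx])] at key
  simp only [Complex.real_smul]
  exact eq_neg_of_add_eq_zero_left key

end IsPrimitive

/-! ### Du Bois-Reymond's lemma and Sobolev functions on an interval. -/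

/-- A smooth compactly supported function of integral zero in an interval is the derivative of
another one. -/
lemma exists_deriv_eq_of_integral_eq_zero {Ω : Set ℝ} (hΩ : Ω.OrdConnected) {θ : ℝ → ℝ}
    (hθ : ContDiff ℝ (⊤ : ℕ∞) θ) (hc : HasCompactSupport θ) (hs : tsupport θ ⊆ Ω)
    (h0 : ∫ x, θ x = 0) :
    ∃ φ : ℝ → ℝ, ContDiff ℝ (⊤ : ℕ∞) φ ∧ HasCompactSupport φ ∧ tsupport φ ⊆ Ω ∧ deriv φ = θ := by
  rcases (tsupport θ).eq_empty_or_nonempty with he | hne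
  · refine ⟨θ, hθ, hc, hs, ?_⟩
    rw [tsupport_eq_empty_iff.1 he]
    ext x
    simp
  set m := sInf (tsupport θ) with hm
  set M := sSup (tsupport θ) with hM
  have hmΩ : m ∈ Ω := hs (hc.isCompact.sInf_mem hne)
  have hMΩ : M ∈ Ω := hs (hc.isCompact.sSup_mem hne)
  have hzero : ∀ x, x ∉ Set.Icc m M → θ x = 0 := fun x hx =>
    image_eq_zero_of_notMem_tsupport fun hh =>
      hx ⟨csInf_le hc.isCompact.bddBelow hh, le_csSup hc.isCompact.bddAbove hh⟩
  have hcont := hθ.continuous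
  -- Starting to the left of the support makes `φ` vanish before `m`; beyond `M` it equals the total
  -- integral, which is zero.
  let φ : ℝ → ℝ := fun x => ∫ t in (m - 1)..x, θ t
  have hd : ∀ x, HasDerivAt φ (θ x) x := fun x =>
    intervalIntegral.integral_hasDerivAt_right (hcont.intervalIntegrable _ _)
      (hcont.stronglyMeasurableAtFilter _ _) hcont.continuousAt
  have hderiv : deriv φ = θ := funext fun x => (hd x).deriv
  have hφ0 : ∀ x, x ∉ Set.Icc m M → φ x = 0 := by
    intro x hx
    by_cases hxm : x < m
    · have : φ x = ∫ t in (m - 1)..x, (0 : ℝ) := by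
        refine intervalIntegral.integral_congr fun t ht => hzero t fun ht' => ?_
        have := ht.2
        have h3 : max (m - 1) x < m := max_lt (by linarith) hxm
        exact absurd ht'.1 (not_le.2 (this.trans_lt h3))
      rw [this, intervalIntegral.integral_zero]
    · have hxM : M < x := by
        by_contra h
        exact hx ⟨not_lt.1 hxm, not_lt.1 h⟩
      change ∫ t in (m - 1)..x, θ t = 0
      rw [intervalIntegral.integral_eq_integral_of_support_subset, h0]
      intro t ht
      by_contra hcon
      refine ht (hzero t fun ht' => hcon ⟨by linarith [ht'.1], by linarith [ht'.2]⟩)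
  have hsub : tsupport φ ⊆ Set.Icc m M :=
    closure_minimal (fun x hx => by_contra fun h => hx (hφ0 x h)) isClosed_Icc
  refine ⟨φ, ?_, HasCompactSupport.of_support_subset_isCompact isCompact_Icc
    (subset_closure.trans hsub), hsub.trans (hΩ.out hmΩ hMΩ), hderiv⟩
  rw [contDiff_infty_iff_deriv, hderiv]
  exact ⟨fun x => (hd x).differentiableAt, hθ⟩

/-- The du Bois-Reymond lemma. -/
lemma ae_eq_const_of_integral_deriv_smul_eq_zero {Ω : Set ℝ} (hΩ : IsOpen Ω)
    (hΩ' : Ω.OrdConnected) (hne : Ω.Nonempty) {h : ℝ → ℂ} (hloc : LocallyIntegrableOn h Ω volume)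
    (h0 : ∀ φ : ℝ → ℝ, ContDiff ℝ (⊤ : ℕ∞) φ → HasCompactSupport φ → tsupport φ ⊆ Ω →
      ∫ x in Ω, deriv φ x • h x = 0) :
    ∃ c : ℂ, h =ᵐ[volume.restrict Ω] fun _ => c := by
  obtain ⟨x₀, hx₀⟩ := hne
  obtain ⟨r, hr, hball⟩ := Metric.nhds_basis_closedBall.mem_iff.1 (hΩ.mem_nhds hx₀)
  let b : ContDiffBump x₀ := ⟨r / 2, r, by positivity, by linarith⟩
  let η : ℝ → ℝ := b.normed volume
  have hη : ContDiff ℝ (⊤ : ℕ∞) η := b.contDiff_normed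
  have hηc : HasCompactSupport η := b.hasCompactSupport_normed
  have hηs : tsupport η ⊆ Ω := by
    rw [show tsupport η = _ from b.tsupport_normed_eq]
    exact hball
  have hη1 : ∫ x, η x = 1 := b.integral_normed
  have hint : ∀ ψ : ℝ → ℝ, Continuous ψ → HasCompactSupport ψ → tsupport ψ ⊆ Ω →
      IntegrableOn (fun x => ψ x • h x) Ω := by
    intro ψ hψ hψc hψs
    have h1 : IntegrableOn (fun x => ψ x • h x) (tsupport ψ) :=
      (hloc.integrableOn_compact_subset hψs hψc.isCompact).continuousOn_smul hψ.continuousOn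
        hψc.isCompact
    refine ((integrableOn_iff_integrable_of_support_subset ?_).1 h1).integrableOn
    exact fun x hx => subset_tsupport ψ fun h' => hx (by simp [h'])
  refine ⟨∫ x in Ω, η x • h x, ?_⟩
  set c := ∫ x in Ω, η x • h x with hc
  have hloc' : LocallyIntegrableOn (fun x => h x - c) Ω volume :=
    hloc.sub ((locallyIntegrable_const c).locallyIntegrableOn Ω)
  -- Subtracting `(∫ ψ) η` from a test function `ψ` leaves integral zero, hence a derivative `φ'`.
  -- The hypothesis for `φ` then reads `∫ ψ (h - c) = 0` with `c = ∫ η h`.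
  have key := hΩ.ae_eq_zero_of_integral_contDiff_smul_eq_zero hloc' (fun ψ hψ hψc hψs => by
    set I := ∫ x, ψ x with hI
    let θ : ℝ → ℝ := fun x => ψ x - I * η x
    have hθs : tsupport θ ⊆ tsupport ψ ∪ tsupport η := by
      refine closure_minimal (fun x hx => ?_) (hψc.isCompact.union hηc.isCompact).isClosed
      by_contra hcon
      rw [Set.mem_union, not_or] at hcon
      exact hx (by simp [θ, image_eq_zero_of_notMem_tsupport hcon.1,
        image_eq_zero_of_notMem_tsupport hcon.2])
    obtain ⟨φ, h1, h2, h3, h4⟩ := exists_deriv_eq_of_integral_eq_zero hΩ' (θ := θ)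
      (hψ.sub (contDiff_const.mul hη))
      ((hψc.isCompact.union hηc.isCompact).of_isClosed_subset isClosed_closure hθs)
      (hθs.trans (Set.union_subset hψs hηs)) (by
        rw [integral_sub (hψ.continuous.integrable_of_hasCompactSupport hψc)
          ((hη.continuous.integrable_of_hasCompactSupport hηc).const_mul I),
          integral_const_mul, hη1, mul_one, sub_self])
    have h5 := h0 φ h1 h2 h3
    rw [h4] at h5
    have h6 : ∫ x in Ω, θ x • h x = (∫ x in Ω, ψ x • h x) - I • c := by
      simp only [θ, sub_smul, mul_smul]
      rw [hc, ← integral_smul]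
      exact integral_sub (hint ψ hψ.continuous hψc hψs) ((hint η hη.continuous hηc hηs).smul I)
    have hψ0 : ∀ x, x ∉ Ω → ψ x = 0 := fun x hx =>
      image_eq_zero_of_notMem_tsupport fun hh => hx (hψs hh)
    have h7 : ∫ x in Ω, ψ x • c = I • c := by
      rw [setIntegral_eq_integral_of_forall_compl_eq_zero fun x hx => by rw [hψ0 x hx, zero_smul],
        integral_smul_const]
    rw [← setIntegral_eq_integral_of_forall_compl_eq_zero (s := Ω)
      fun x hx => by rw [hψ0 x hx, zero_smul]]
    simp only [smul_sub]
    rw [integral_sub (hint ψ hψ.continuous hψc hψs)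
      ((hψ.continuous.integrable_of_hasCompactSupport hψc).smul_const c).integrableOn, h7, ← h6, h5])
  rw [EventuallyEq, ae_restrict_iff' hΩ.measurableSet]
  filter_upwards [key] with x hx hxΩ
  exact sub_eq_zero.1 (hx hxΩ)

lemma locallyIntegrable_indicator_L2 {Ω : Set ℝ} (hΩ : IsOpen Ω) (g : L2 Ω) :
    LocallyIntegrable (Ω.indicator g) volume := by
  have h : MemLp (Ω.indicator g) 2 volume :=
    (memLp_indicator_iff_restrict hΩ.measurableSet).2 (Lp.memLp g)
  exact h.locallyIntegrable (by norm_num)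

lemma indicator_ae_eq_restrict' {Ω : Set ℝ} (hΩ : IsOpen Ω) (g : ℝ → ℂ) :
    Ω.indicator g =ᵐ[volume.restrict Ω] g :=
  indicator_ae_eq_restrict hΩ.measurableSet

lemma IsPrimitive.hasWeakDeriv {Ω : Set ℝ} {F f : ℝ → ℂ} (h : IsPrimitive F f) {u v : L2 Ω}
    (hu : (u : ℝ → ℂ) =ᵐ[volume.restrict Ω] F) (hv : (v : ℝ → ℂ) =ᵐ[volume.restrict Ω] f) :
    HasWeakDeriv Ω u v := by
  intro φ hφ hc hs
  have h1 : ∫ x in Ω, deriv φ x • u x = ∫ x in Ω, deriv φ x • F x :=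
    integral_congr_ae (hu.mono fun x hx => by simp only [hx])
  have h2 : ∫ x in Ω, φ x • v x = ∫ x in Ω, φ x • f x :=
    integral_congr_ae (hv.mono fun x hx => by simp only [hx])
  rw [h1, h2]
  exact h.integral_deriv_smul hφ hc hs

/-- An element of `H¹` of an interval is a.e. equal to a primitive of its weak derivative. -/
lemma HasWeakDeriv.exists_isPrimitive {Ω : Set ℝ} (hΩ : IsOpen Ω) (hΩ' : Ω.OrdConnected)
    (hne : Ω.Nonempty) {f g : L2 Ω} (h : HasWeakDeriv Ω f g) :
    ∃ F, IsPrimitive F (Ω.indicator g) ∧ (f : ℝ → ℂ) =ᵐ[volume.restrict Ω] F := by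
  have hloc := locallyIntegrable_indicator_L2 hΩ g
  have hP := isPrimitive_integral hloc 0
  set P : ℝ → ℂ := fun x => 0 + ∫ t in (0 : ℝ)..x, Ω.indicator g t with hPdef
  have hlocf : LocallyIntegrableOn (fun x => f x) Ω volume :=
    locallyIntegrableOn_of_locallyIntegrable_restrict
      ((Lp.memLp f).locallyIntegrable (by norm_num))
  -- `f - P` has weak derivative zero, where `P` is a primitive of `g` extended by zero to the line.
  obtain ⟨c, hc⟩ := ae_eq_const_of_integral_deriv_smul_eq_zero hΩ hΩ' hne
    (hlocf.sub (hP.continuous.locallyIntegrable.locallyIntegrableOn Ω)) (fun φ hφ hφc hφs => by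
      have hdc : Continuous (deriv φ) := hφ.continuous_deriv (by simp)
      simp only [Pi.sub_apply, smul_sub]
      have hi : IntegrableOn (fun x => deriv φ x • P x) Ω := ((hdc.smul hP.continuous).integrable_of_hasCompactSupport
          hφc.deriv.smul_right).integrableOn
      rw [integral_sub (integrable_smul_L2 hdc hφc.deriv f) hi, h φ hφ hφc hφs, hP.integral_deriv_smul hφ hφc hφs,
        integral_congr_ae ((indicator_ae_eq_restrict' hΩ g).mono fun x hx => by
          simp only [hx] : (fun x => φ x • Ω.indicator g x) =ᵐ[volume.restrict Ω]
            fun x => φ x • g x), sub_self])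
  refine ⟨fun x => c + ∫ t in (0 : ℝ)..x, Ω.indicator g t, isPrimitive_integral hloc c, ?_⟩
  filter_upwards [hc] with x hx
  simp only [Pi.sub_apply, hPdef, zero_add] at hx
  rw [← hx]
  ring

lemma HasWeakDeriv.exists_isContRep {Ω : Set ℝ} (hΩ : IsOpen Ω) (hΩ' : Ω.OrdConnected)
    (hne : Ω.Nonempty) {f g : L2 Ω} (h : HasWeakDeriv Ω f g) : ∃ F, IsContRep Ω f F := by
  obtain ⟨F, h1, h2⟩ := h.exists_isPrimitive hΩ hΩ' hne
  exact ⟨F, h1.continuous.continuousOn, h2⟩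

/-- The primitive whose derivative is that of the pairing of two elements of `H¹`. -/
lemma HasWeakDeriv.exists_isPrimitive_inner {Ω : Set ℝ} (hΩ : IsOpen Ω) (hΩ' : Ω.OrdConnected)
    (hne : Ω.Nonempty) {f f' g g' : L2 Ω} (hf : HasWeakDeriv Ω f f') (hg : HasWeakDeriv Ω g g') :
    ∃ Q q : ℝ → ℂ, IsPrimitive Q q ∧ Integrable q (volume.restrict Ω) ∧
      Integrable Q (volume.restrict Ω) ∧
      inner ℂ f g' + inner ℂ f' g = ∫ x in Ω, q x ∧
      ∀ x ∈ closure Ω, Q x = (starRingEnd ℂ) (pointValue Ω f x) * pointValue Ω g x := by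
  obtain ⟨F, hF, hfF⟩ := hf.exists_isPrimitive hΩ hΩ' hne
  obtain ⟨G, hG, hgG⟩ := hg.exists_isPrimitive hΩ hΩ' hne
  have hf' := indicator_ae_eq_restrict' hΩ f'
  have hg' := indicator_ae_eq_restrict' hΩ g'
  have h1 : Integrable (fun x => inner ℂ (f x) (g' x)) (volume.restrict Ω) :=
    L2.integrable_inner f g'
  have h2 : Integrable (fun x => inner ℂ (f' x) (g x)) (volume.restrict Ω) :=
    L2.integrable_inner f' g
  have h3 : Integrable (fun x => inner ℂ (f x) (g x)) (volume.restrict Ω) :=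
    L2.integrable_inner f g
  have e : (fun x => (inner ℂ (f x) (g' x) + inner ℂ (f' x) (g x) : ℂ)) =ᵐ[volume.restrict Ω]
      fun x => (starRingEnd ℂ) (Ω.indicator f' x) * G x +
        (starRingEnd ℂ) (F x) * Ω.indicator g' x := by
    filter_upwards [hfF, hgG, hf', hg'] with x h1 h2 h3 h4
    rw [h1, h2, h3, h4]
    simp only [RCLike.inner_apply]
    ring
  refine ⟨_, _, hF.conj.mul hG, (h1.add h2).congr e, ?_, ?_, fun x hx => ?_⟩
  · refine h3.congr ?_
    filter_upwards [hfF, hgG] with x h1 h2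
    rw [h1, h2, RCLike.inner_apply, mul_comm]
  · rw [L2.inner_def, L2.inner_def, ← integral_add h1 h2]
    exact integral_congr_ae e
  · rw [IsContRep.pointValue_eq hΩ ⟨hF.continuous.continuousOn, hfF⟩ hx,
      IsContRep.pointValue_eq hΩ ⟨hG.continuous.continuousOn, hgG⟩ hx]

lemma HasWeakDeriv.inner_add_inner_Ioo {l : ℝ} (hl : 0 < l) {f f' g g' : L2 (Set.Ioo 0 l)}
    (hf : HasWeakDeriv _ f f') (hg : HasWeakDeriv _ g g') :
    inner ℂ f g' + inner ℂ f' g =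
      (starRingEnd ℂ) (pointValue _ f l) * pointValue _ g l -
        (starRingEnd ℂ) (pointValue _ f 0) * pointValue _ g 0 := by
  obtain ⟨Q, q, hQ, -, -, h1, h2⟩ := hf.exists_isPrimitive_inner isOpen_Ioo Set.ordConnected_Ioo
    (Set.nonempty_Ioo.2 hl) hg
  rw [closure_Ioo hl.ne] at h2
  rw [h1, ← h2 l (Set.right_mem_Icc.2 hl.le), ← h2 0 (Set.left_mem_Icc.2 hl.le),
    ← hQ.integral_eq, intervalIntegral.integral_of_le hl.le, integral_Ioc_eq_integral_Ioo]

lemma HasWeakDeriv.inner_add_inner_Ioi {f f' g g' : L2 (Set.Ioi (0 : ℝ))}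
    (hf : HasWeakDeriv _ f f') (hg : HasWeakDeriv _ g g') :
    inner ℂ f g' + inner ℂ f' g = -((starRingEnd ℂ) (pointValue _ f 0) * pointValue _ g 0) := by
  obtain ⟨Q, q, hQ, h3, h4, h1, h2⟩ := hf.exists_isPrimitive_inner isOpen_Ioi Set.ordConnected_Ioi
    Set.nonempty_Ioi hg
  rw [closure_Ioi] at h2
  have h5 : Tendsto (fun x => Q x - Q 0) atTop (𝓝 (∫ x in Set.Ioi 0, q x)) :=
    (intervalIntegral_tendsto_integral_Ioi 0 h3 tendsto_id).congr fun x => hQ.integral_eq 0 x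
  have h6 : Tendsto Q atTop (𝓝 ((∫ x in Set.Ioi 0, q x) + Q 0)) := by
    simpa using h5.add_const (Q 0)
  -- Integrability of `q` gives `Q` a limit at infinity, and integrability of `Q` forces that limit
  -- to be zero. Infinity contributes no boundary term.
  have h7 := IntegrableAtFilter.eq_zero_of_tendsto (μ := volume)
    ⟨Set.Ioi 0, Ioi_mem_atTop 0, h4⟩ (fun s hs => by
      obtain ⟨a, ha⟩ := mem_atTop_sets.1 hs
      exact measure_mono_top (fun x (hx : a ≤ x) => ha x hx) Real.volume_Ici) h6
  rw [h1, ← h2 0 Set.self_mem_Ici]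
  exact eq_neg_of_add_eq_zero_left h7

lemma exists_hasWeakDeriv_of_hasDerivAt {Ω : Set ℝ} {F f : ℝ → ℂ}
    (hF : ∀ x, HasDerivAt F (f x) x) (hf : Continuous f) (hF2 : MemLp F 2 (volume.restrict Ω))
    (hf2 : MemLp f 2 (volume.restrict Ω)) :
    ∃ u u' : L2 Ω, HasWeakDeriv Ω u u' ∧ IsContRep Ω u F :=
  ⟨hF2.toLp F, hf2.toLp f,
    (isPrimitive_of_hasDerivAt hF hf).hasWeakDeriv hF2.coeFn_toLp hf2.coeFn_toLp,
    (continuous_iff_continuousAt.2 fun x => (hF x).continuousAt).continuousOn, hF2.coeFn_toLp⟩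

/-- Affine interpolation. Together with the exponential on the half-line it serves to represent
endpoint values as inner products and to build functions with prescribed vertex values. -/
lemma exists_hasWeakDeriv_Ioo {l : ℝ} (hl : 0 < l) (a b : ℂ) :
    ∃ u u' : L2 (Set.Ioo 0 l), HasWeakDeriv _ u u' ∧ pointValue _ u 0 = a ∧
      pointValue _ u l = b := by
  have hlc : (l : ℂ) ≠ 0 := by exact_mod_cast hl.ne'
  have hd : ∀ x : ℝ, HasDerivAt (fun x : ℝ => a + x * ((b - a) / l)) ((b - a) / l) x := fun x => by
    simpa using ((Complex.ofRealCLM.hasDerivAt (x := x)).mul_const ((b - a) / l)).const_add a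
  have hcont : Continuous fun x : ℝ => a + x * ((b - a) / l) := by fun_prop
  have hm : ∀ F : ℝ → ℂ, Continuous F → MemLp F 2 (volume.restrict (Set.Ioo 0 l)) := by
    intro F hF
    obtain ⟨C, hC⟩ := (isCompact_Icc (a := (0 : ℝ)) (b := l)).exists_bound_of_continuousOn
      hF.continuousOn
    refine MemLp.of_bound hF.aestronglyMeasurable C ?_
    filter_upwards [ae_restrict_mem measurableSet_Ioo] with x hx
    exact hC x (Set.Ioo_subset_Icc_self hx)
  obtain ⟨u, u', h1, h2⟩ := exists_hasWeakDeriv_of_hasDerivAt hd continuous_const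
    (hm _ hcont) (hm _ continuous_const)
  refine ⟨u, u', h1, ?_, ?_⟩
  · rw [h2.pointValue_eq isOpen_Ioo (by rw [closure_Ioo hl.ne]; exact Set.left_mem_Icc.2 hl.le)]
    simp
  · rw [h2.pointValue_eq isOpen_Ioo (by rw [closure_Ioo hl.ne]; exact Set.right_mem_Icc.2 hl.le)]
    field_simp
    ring

lemma exists_hasWeakDeriv_Ioi (a : ℂ) :
    ∃ u u' : L2 (Set.Ioi (0 : ℝ)), HasWeakDeriv _ u u' ∧ pointValue _ u 0 = a := by
  have hd : ∀ x : ℝ, HasDerivAt (fun x : ℝ => (Real.exp (-x) : ℂ) * a)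
      (-((Real.exp (-x) : ℂ) * a)) x := fun x => by
    have := (((Real.hasDerivAt_exp (-x)).comp x (hasDerivAt_neg x)).ofReal_comp).mul_const a
    simpa using this
  have hcont : Continuous fun x : ℝ => (Real.exp (-x) : ℂ) * a := by fun_prop
  have hm : MemLp (fun x : ℝ => (Real.exp (-x) : ℂ) * a) 2 (volume.restrict (Set.Ioi 0)) := by
    rw [memLp_two_iff_integrable_sq_norm hcont.aestronglyMeasurable]
    have h2 : IntegrableOn (fun x : ℝ => Real.exp (-2 * x)) (Set.Ioi 0) :=
      exp_neg_integrableOn_Ioi 0 two_pos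
    refine (h2.mul_const (‖a‖ ^ 2)).congr (Eventually.of_forall fun x => ?_)
    simp only [norm_mul, Complex.norm_real, Real.norm_eq_abs, Real.abs_exp, mul_pow]
    rw [← Real.exp_nat_mul]
    congr 2
    push_cast
    ring
  obtain ⟨u, u', h1, h2⟩ := exists_hasWeakDeriv_of_hasDerivAt hd hcont.neg hm hm.neg
  refine ⟨u, u', h1, ?_⟩
  rw [h2.pointValue_eq isOpen_Ioi (by rw [closure_Ioi]; exact Set.self_mem_Ici)]
  simp

end Primitives

/-! ### Differentiation along the orbits of a group. -/

section GroupOrbits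

variable {E F : Type*} [NormedAddCommGroup E] [NormedSpace ℂ E] [NormedAddCommGroup F]
  [InnerProductSpace ℂ F] {A : E →ₗ.[ℂ] E} {T : ℝ → E →L[ℂ] E}

/-- `T t` is continuous and commutes with the difference quotients that define the generator, so it
preserves the domain and commutes with `A`. -/
lemma IsC0GroupGeneratedBy.graph_apply (hT : IsC0GroupGeneratedBy A T) {x y : E}
    (h : (x, y) ∈ A.graph) (t : ℝ) : (T t x, T t y) ∈ A.graph := by
  rw [hT.generator] at h ⊢
  refine (((T t).continuous.tendsto y).comp h).congr fun s => ?_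
  have h1 : T t (T s x) = T s (T t x) := by
    rw [← mul_apply_eq_comp, ← mul_apply_eq_comp, ← hT.map_add t s,
      ← hT.map_add s t, add_comm]
  simp only [Function.comp_apply, map_smul, map_sub, h1]

lemma IsC0GroupGeneratedBy.hasDerivAt_apply (hT : IsC0GroupGeneratedBy A T) {x y : E}
    (h : (x, y) ∈ A.graph) (t : ℝ) : HasDerivAt (fun s => T s x) (T t y) t := by
  have h1 := (hT.generator _ _).1 (hT.graph_apply h t)
  rw [hasDerivAt_iff_tendsto_slope_zero]
  refine h1.congr fun s => ?_
  rw [add_comm t s, hT.map_add s t, mul_apply_eq_comp, ← Complex.ofReal_inv, Complex.coe_smul]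

/-- To be applied with `L` the restriction to one edge. The derivative is returned as a real number
because the two inner products are conjugate to each other. -/
lemma IsC0GroupGeneratedBy.exists_hasDerivAt_norm_sq (hT : IsC0GroupGeneratedBy A T) {x y : E}
    (h : (x, y) ∈ A.graph) (L : E →L[ℂ] F) (t : ℝ) :
    ∃ r : ℝ, HasDerivAt (fun s => ‖L (T s x)‖ ^ 2) r t ∧
      (r : ℂ) = inner ℂ (L (T t x)) (L (T t y)) + inner ℂ (L (T t y)) (L (T t x)) := by
  have h1 : HasDerivAt (fun s => L (T s x)) (L (T t y)) t :=
    (L.restrictScalars ℝ).hasFDerivAt.comp_hasDerivAt t (hT.hasDerivAt_apply h t)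
  have h2 := Complex.reCLM.hasFDerivAt.comp_hasDerivAt t (h1.inner ℂ h1)
  refine ⟨_, h2.congr_of_eventuallyEq (Eventually.of_forall fun s => ?_), ?_⟩
  · simp only [Function.comp_apply, Complex.reCLM_apply]
    exact (inner_self_eq_norm_sq (𝕜 := ℂ) _).symm
  · rw [Complex.reCLM_apply]
    refine Complex.conj_eq_iff_re.1 ?_
    rw [_root_.map_add, inner_conj_symm, inner_conj_symm, add_comm]

end GroupOrbits

/-! ### Test functions as elements of `L²`. -/

lemma continuous_integral_smul {Ω : Set ℝ} {φ : ℝ → ℝ} (hφ : Continuous φ)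
    (hc : HasCompactSupport φ) : Continuous fun f : L2 Ω => ∫ x in Ω, φ x • f x := by
  have hm : MemLp (fun x => (φ x : ℂ)) 2 (volume.restrict Ω) :=
    (Complex.continuous_ofReal.comp hφ).memLp_of_hasCompactSupport
      (hc.comp_left Complex.ofReal_zero)
  have : (fun f : L2 Ω => ∫ x in Ω, φ x • f x) = fun f => inner ℂ (hm.toLp _) f := by
    ext f
    rw [L2.inner_def]
    refine integral_congr_ae ?_
    filter_upwards [hm.coeFn_toLp] with x hx
    rw [hx, RCLike.inner_apply, Complex.conj_ofReal, Complex.real_smul, mul_comm]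
  rw [this]
  fun_prop

/-- Each test function imposes an equation between continuous functionals of the pair. -/
lemma isClosed_setOf_hasWeakDeriv (Ω : Set ℝ) :
    IsClosed {x : L2 Ω × L2 Ω | HasWeakDeriv Ω x.1 x.2} := by
  simp only [HasWeakDeriv, Set.ofPred_forall]
  refine isClosed_iInter fun φ => isClosed_iInter fun hφ => isClosed_iInter fun hc =>
    isClosed_iInter fun _ => isClosed_eq ?_ ?_
  · exact (continuous_integral_smul (hφ.continuous_deriv (by simp)) hc.deriv).comp continuous_fst
  · exact ((continuous_integral_smul hφ.continuous hc).comp continuous_snd).neg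

/-- A test function and its derivative as elements of `L²`. -/
lemma exists_testFunction {Ω : Set ℝ} (hΩ : IsOpen Ω) {φ : ℝ → ℝ} (hφ : ContDiff ℝ (⊤ : ℕ∞) φ)
    (hc : HasCompactSupport φ) (hs : tsupport φ ⊆ Ω) :
    ∃ w w' : L2 Ω, HasWeakDeriv Ω w w' ∧ (∀ x ∈ closure Ω, x ∉ Ω → pointValue Ω w x = 0) ∧
      (∀ f, inner ℂ w f = ∫ x in Ω, φ x • f x) ∧
      ∀ f, inner ℂ w' f = ∫ x in Ω, deriv φ x • f x := by
  have hm : ∀ ψ : ℝ → ℝ, Continuous ψ → HasCompactSupport ψ →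
      MemLp (fun x => (ψ x : ℂ)) 2 (volume.restrict Ω) := fun ψ hψ hψc =>
    (Complex.continuous_ofReal.comp hψ).memLp_of_hasCompactSupport
      (hψc.comp_left Complex.ofReal_zero)
  have hin : ∀ (ψ : ℝ → ℝ) (hψ : MemLp (fun x => (ψ x : ℂ)) 2 (volume.restrict Ω)) (f : L2 Ω),
      inner ℂ (hψ.toLp _) f = ∫ x in Ω, ψ x • f x := fun ψ hψ f => by
    rw [L2.inner_def]
    refine integral_congr_ae ?_
    filter_upwards [hψ.coeFn_toLp] with x hx
    rw [hx, RCLike.inner_apply, Complex.conj_ofReal, Complex.real_smul, mul_comm]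
  have hdc : Continuous (deriv φ) := hφ.continuous_deriv (by simp)
  have hdφ : ∀ x, HasDerivAt (fun x => (φ x : ℂ)) ((deriv φ x : ℝ) : ℂ) x := fun x =>
    ((hφ.differentiable (by simp)).differentiableAt.hasDerivAt).ofReal_comp
  have h1 := hm φ hφ.continuous hc
  have h2 := hm _ hdc hc.deriv
  have hrep : IsContRep Ω (h1.toLp _) fun x => (φ x : ℂ) :=
    ⟨(Complex.continuous_ofReal.comp hφ.continuous).continuousOn, h1.coeFn_toLp⟩
  refine ⟨h1.toLp _, h2.toLp _, (isPrimitive_of_hasDerivAt hdφ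
    (Complex.continuous_ofReal.comp hdc)).hasWeakDeriv h1.coeFn_toLp h2.coeFn_toLp,
    fun x hx hxΩ => ?_, hin φ h1, hin _ h2⟩
  rw [hrep.pointValue_eq hΩ hx, image_eq_zero_of_notMem_tsupport fun h => hxΩ (hs h),
    Complex.ofReal_zero]

lemma integral_probDensity (Ω : Set ℝ) (f : L2 Ω) : ∫ x in Ω, probDensity Ω f x = ‖f‖ ^ 2 := by
  have h1 : (inner ℂ f f : ℂ) = ((‖f‖ ^ 2 : ℝ) : ℂ) := by
    rw [inner_self_eq_norm_sq_to_K]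
    push_cast
    rfl
  rw [L2.inner_def] at h1
  have h2 : ∀ x, (inner ℂ (f x) (f x) : ℂ) = ((probDensity Ω f x : ℝ) : ℂ) := fun x => by
    rw [inner_self_eq_norm_sq_to_K, probDensity]
    push_cast
    rfl
  simp only [h2] at h1
  rw [integral_complex_ofReal] at h1
  exact_mod_cast h1

end QuantumGraph

open QuantumGraph

/-! ### Edge ends and boundary values on the graph. -/

namespace MetricGraph

variable {V B U : Type*} (G : MetricGraph V B U)

lemma ordConnected_edge (k : B ⊕ U) : (G.edge k).OrdConnected := by
  cases k
  · exact Set.ordConnected_Ioo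
  · exact Set.ordConnected_Ioi

lemma nonempty_edge (k : B ⊕ U) : (G.edge k).Nonempty :=
  closure_nonempty_iff.1 ⟨0, G.zero_mem_closure_edge k⟩

lemma exists_isContRep {k : B ⊕ U} {f g : L2 (G.edge k)} (h : HasWeakDeriv (G.edge k) f g) :
    ∃ F, IsContRep (G.edge k) f F :=
  h.exists_isContRep (G.isOpen_edge k) (G.ordConnected_edge k) (G.nonempty_edge k)

lemma inner_add_inner_bounded {b : B} {f f' g g' : L2 (G.edge (Sum.inl b : B ⊕ U))}
    (hf : HasWeakDeriv _ f f') (hg : HasWeakDeriv _ g g') :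
    inner ℂ f g' + inner ℂ f' g =
      (starRingEnd ℂ) (pointValue _ f (G.len b)) * pointValue _ g (G.len b) -
        (starRingEnd ℂ) (pointValue _ f 0) * pointValue _ g 0 :=
  HasWeakDeriv.inner_add_inner_Ioo (G.len_pos b) hf hg

/-- The edge of an edge end: the ends are the left ends of the bounded edges, the right ends of the
bounded edges, and the ends of the unbounded edges. -/
def endEdge : B ⊕ B ⊕ U → B ⊕ U
  | Sum.inl b => Sum.inl b
  | Sum.inr (Sum.inl b) => Sum.inl b
  | Sum.inr (Sum.inr k) => Sum.inr k

/-- The coordinate of an edge end. -/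
def endPoint : B ⊕ B ⊕ U → ℝ
  | Sum.inl _ => 0
  | Sum.inr (Sum.inl b) => G.len b
  | Sum.inr (Sum.inr _) => 0

/-- The vertex at an edge end. -/
def endVertex : B ⊕ B ⊕ U → V
  | Sum.inl b => G.start b
  | Sum.inr (Sum.inl b) => G.finish b
  | Sum.inr (Sum.inr k) => G.root k

lemma endPoint_mem_closure (e : B ⊕ B ⊕ U) : G.endPoint e ∈ closure (G.edge (endEdge e)) := by
  rcases e with b | b | k
  · exact G.zero_mem_closure_edge _
  · exact G.len_mem_closure_edge _
  · exact G.zero_mem_closure_edge _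

lemma endPoint_notMem (e : B ⊕ B ⊕ U) : G.endPoint e ∉ G.edge (endEdge e) := by
  rcases e with b | b | k
  · exact fun h => lt_irrefl _ h.1
  · exact fun h => lt_irrefl _ h.2
  · exact lt_irrefl (0 : ℝ)

/-- The point values at the edge ends are given by inner products in `H¹`. -/
lemma exists_trace (e : B ⊕ B ⊕ U) : ∃ τ τ' : L2 (G.edge (endEdge e)),
    ∀ u u' : L2 (G.edge (endEdge e)), HasWeakDeriv _ u u' →
      pointValue _ u (G.endPoint e) = inner ℂ τ u + inner ℂ τ' u' := by
  rcases e with b | b | k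
  -- Integration by parts against `h` leaves only the value of `u` at the chosen end. The value `-1`
  -- offsets the minus sign of the boundary term at `0`.
  · obtain ⟨h, h', h1, h2, h3⟩ := exists_hasWeakDeriv_Ioo (G.len_pos b) (-1) 0
    refine ⟨h', h, fun u u' hu => ?_⟩
    have := h1.inner_add_inner_Ioo (G.len_pos b) hu
    rw [h2, h3] at this
    rw [add_comm]
    refine Eq.trans ?_ this.symm
    simp [endPoint, edge, endEdge]
  · obtain ⟨h, h', h1, h2, h3⟩ := exists_hasWeakDeriv_Ioo (G.len_pos b) 0 1
    refine ⟨h', h, fun u u' hu => ?_⟩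
    have := h1.inner_add_inner_Ioo (G.len_pos b) hu
    rw [h2, h3] at this
    rw [add_comm]
    refine Eq.trans ?_ this.symm
    simp [endPoint, edge, endEdge]
  · obtain ⟨h, h', h1, h2⟩ := exists_hasWeakDeriv_Ioi (-1)
    refine ⟨h', h, fun u u' hu => ?_⟩
    have := h1.inner_add_inner_Ioi hu
    rw [h2] at this
    rw [add_comm]
    refine Eq.trans ?_ this.symm
    simp [endPoint, edge, endEdge]

variable [Fintype B] [Fintype U]

/-- `u` is continuous on the graph with value `c v` at the vertex `v`, and vanishes at the exterior
vertices. -/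
structure HasVertexValues (u : G.L2Graph) (c : V → ℂ) : Prop where
  val_eq : ∀ e, G.val u (endEdge e) (G.endPoint e) = c (G.endVertex e)
  exterior : ∀ v, G.IsExterior v → c v = 0

/-- `p` is the edgewise weak derivative of `u`. -/
def HasEdgeDeriv (u p : G.L2Graph) : Prop := ∀ k, HasWeakDeriv (G.edge k) (u k) (p k)

variable {G}

lemma MemDomain.exists_hasVertexValues {u : G.L2Graph} (hu : G.MemDomain u) :
    ∃ c, G.HasVertexValues u c := by
  obtain ⟨c, h1, h2, h3, h4⟩ := hu.vertex
  refine ⟨c, fun e => ?_, h4⟩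
  rcases e with b | b | k
  exacts [h1 b, h2 b, h3 k]

omit [Fintype B] [Fintype U] in
lemma HasEdgeDeriv.val_add {u p v q : G.L2Graph} (hu : G.HasEdgeDeriv u p)
    (hv : G.HasEdgeDeriv v q) (k : B ⊕ U) {x : ℝ} (hx : x ∈ closure (G.edge k)) :
    G.val (u + v) k x = G.val u k x + G.val v k x :=
  pointValue_add (G.isOpen_edge k) (G.exists_isContRep (hu k)) (G.exists_isContRep (hv k)) hx

omit [Fintype B] [Fintype U] in
lemma HasEdgeDeriv.val_smul {u p : G.L2Graph} (a : ℂ) (hu : G.HasEdgeDeriv u p) (k : B ⊕ U) {x : ℝ}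
    (hx : x ∈ closure (G.edge k)) : G.val (a • u) k x = a * G.val u k x :=
  pointValue_smul (G.isOpen_edge k) a (G.exists_isContRep (hu k)) hx

/-! ### The form domain and the resolvent. -/

variable (G)

/-- The form domain: the `H¹` functions that are continuous on the graph and vanish at the exterior
vertices, paired with their derivatives. -/
def formDomain : Submodule ℂ (WithLp 2 (G.L2Graph × G.L2Graph)) where
  carrier := {x | G.HasEdgeDeriv x.fst x.snd ∧ ∃ c, G.HasVertexValues x.fst c}
  add_mem' := by
    rintro x y ⟨hx, c, hc⟩ ⟨hy, d, hd⟩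
    refine ⟨fun k => (hx k).add (hy k), c + d, fun e => ?_, fun v hv => ?_⟩
    · rw [WithLp.add_fst, hx.val_add hy _ (G.endPoint_mem_closure e), hc.val_eq, hd.val_eq,
        Pi.add_apply]
    · rw [Pi.add_apply, hc.exterior v hv, hd.exterior v hv, add_zero]
  zero_mem' := by
    obtain ⟨c, hc⟩ := (memDomain_zero (G := G)).exists_hasVertexValues
    exact ⟨fun k => hasWeakDeriv_zero _, c, hc⟩
  smul_mem' := by
    rintro a x ⟨hx, c, hc⟩
    refine ⟨fun k => (hx k).smul a, a • c, fun e => ?_, fun v hv => ?_⟩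
    · rw [WithLp.smul_fst, hx.val_smul a _ (G.endPoint_mem_closure e), hc.val_eq, Pi.smul_apply,
        smul_eq_mul]
    · rw [Pi.smul_apply, hc.exterior v hv, smul_zero]

lemma mem_formDomain {x : WithLp 2 (G.L2Graph × G.L2Graph)} :
    x ∈ G.formDomain ↔ G.HasEdgeDeriv x.fst x.snd ∧ ∃ c, G.HasVertexValues x.fst c := Iff.rfl

/-- The end values are continuous functionals `T e` of the pair `(u, u')`, so the vertex conditions
become closed conditions on the `T e`. -/
lemma isClosed_formDomain : IsClosed (G.formDomain : Set (WithLp 2 (G.L2Graph × G.L2Graph))) := by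
  choose τ τ' hτ using G.exists_trace
  let T : B ⊕ B ⊕ U → WithLp 2 (G.L2Graph × G.L2Graph) → ℂ := fun e x =>
    inner ℂ (τ e) (x.fst (endEdge e)) + inner ℂ (τ' e) (x.snd (endEdge e))
  have hT : ∀ e, Continuous (T e) := fun e => by fun_prop
  have heq : (G.formDomain : Set (WithLp 2 (G.L2Graph × G.L2Graph))) =
      {x | G.HasEdgeDeriv x.fst x.snd} ∩
        ({x | ∀ e e', G.endVertex e = G.endVertex e' → T e x = T e' x} ∩
          {x | ∀ e, G.IsExterior (G.endVertex e) → T e x = 0}) := by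
    ext x
    constructor
    · rintro ⟨hx, c, hc⟩
      have hTc : ∀ e, T e x = c (G.endVertex e) := fun e => by
        rw [← hc.val_eq]
        exact (hτ e _ _ (hx _)).symm
      refine ⟨hx, fun e e' h => by rw [hTc, hTc, h], fun e h => by rw [hTc, hc.exterior _ h]⟩
    · rintro ⟨hx, h1, h2⟩
      classical
      -- The value at a vertex is read off at any end there; the default `0` serves vertices that no
      -- edge meets.
      refine ⟨hx, fun v => if h : ∃ e, G.endVertex e = v then T h.choose x else 0,
        fun e => ?_, fun v hv => ?_⟩
      · have hex : ∃ e', G.endVertex e' = G.endVertex e := ⟨e, rfl⟩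
        rw [dif_pos hex, h1 _ _ hex.choose_spec]
        exact hτ e _ _ (hx _)
      · split_ifs with h
        · exact h2 _ (by rwa [h.choose_spec])
        · rfl
  rw [heq]
  refine IsClosed.inter ?_ (IsClosed.inter ?_ ?_)
  · simp only [HasEdgeDeriv, Set.ofPred_forall]
    refine isClosed_iInter fun k => ?_
    have hk : Continuous fun x : WithLp 2 (G.L2Graph × G.L2Graph) => (x.fst k, x.snd k) := by
      fun_prop
    exact (isClosed_setOf_hasWeakDeriv (G.edge k)).preimage hk
  · simp only [Set.ofPred_forall]
    exact isClosed_iInter fun e => isClosed_iInter fun e' => isClosed_iInter fun _ =>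
      isClosed_eq (hT e) (hT e')
  · simp only [Set.ofPred_forall]
    exact isClosed_iInter fun e => isClosed_iInter fun _ => isClosed_eq (hT e) continuous_const

instance : G.formDomain.HasOrthogonalProjection :=
  haveI : CompleteSpace G.formDomain := G.isClosed_formDomain.completeSpace_coe
  inferInstance

/-- The resolvent `(H + 1)⁻¹`. -/
def resolvent : G.L2Graph →L[ℂ] G.L2Graph :=
  (WithLp.fstL 2 ℂ G.L2Graph G.L2Graph).comp (G.formDomain.starProjection.comp
    ((WithLp.prodContinuousLinearEquiv 2 ℂ G.L2Graph G.L2Graph).symm.toContinuousLinearMap.comp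
      (ContinuousLinearMap.inl ℂ G.L2Graph G.L2Graph)))

lemma resolvent_apply (f : G.L2Graph) :
    G.resolvent f = (G.formDomain.starProjection (WithLp.toLp 2 (f, 0))).fst := rfl

/-- An orthogonal projection is symmetric, and so is its compression to the first factor. -/
lemma isSelfAdjoint_resolvent : IsSelfAdjoint G.resolvent := by
  rw [ContinuousLinearMap.isSelfAdjoint_iff_isSymmetric]
  intro f g
  have h := G.formDomain.inner_starProjection_left_eq_right (WithLp.toLp 2 (f, 0))
    (WithLp.toLp 2 (g, 0))
  simp only [WithLp.prod_inner_apply, inner_zero_left, inner_zero_right, add_zero] at h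
  exact h

/-! ### Boundary sums, the domain of `H` and Green's formula. -/

variable {G}

/-- The pairing of `H¹` functions on the graph is a sum over the edge ends. -/
lemma HasEdgeDeriv.inner_add_inner {u p v q : G.L2Graph} (hu : G.HasEdgeDeriv u p)
    (hv : G.HasEdgeDeriv v q) :
    inner ℂ u q + inner ℂ p v =
      (∑ b, (starRingEnd ℂ) (G.val u (Sum.inl b) 0) * -G.val v (Sum.inl b) 0) +
      (∑ b, (starRingEnd ℂ) (G.val u (Sum.inl b) (G.len b)) * G.val v (Sum.inl b) (G.len b)) +
      ∑ k, (starRingEnd ℂ) (G.val u (Sum.inr k) 0) * -G.val v (Sum.inr k) 0 := by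
  rw [PiLp.inner_apply, PiLp.inner_apply, ← Finset.sum_add_distrib, Fintype.sum_sum_type,
    ← Finset.sum_add_distrib]
  congr 1
  · refine Finset.sum_congr rfl fun b _ => ?_
    refine (G.inner_add_inner_bounded (hu (Sum.inl b)) (hv (Sum.inl b))).trans ?_
    simp only [val]
    ring
  · refine Finset.sum_congr rfl fun k _ => ?_
    refine (HasWeakDeriv.inner_add_inner_Ioi (hu (Sum.inr k)) (hv (Sum.inr k))).trans ?_
    simp only [val, edge]
    ring

lemma sum_mul_eq_sum_fiber {ι : Type*} [Fintype ι] [DecidableEq V] (f : ι → V) (c : V → ℂ)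
    (a : ι → ℂ) {S : Finset V} (hS : ∀ i, f i ∈ S) :
    ∑ i, c (f i) * a i = ∑ v ∈ S, c v * ∑ i, if f i = v then a i else 0 := by
  simp only [Finset.mul_sum]
  rw [Finset.sum_comm]
  refine Finset.sum_congr rfl fun i _ => ?_
  rw [Finset.sum_eq_single (f i)]
  · simp
  · intro v _ hv
    rw [if_neg hv.symm, mul_zero]
  · exact fun h => absurd (hS i) h

variable (G)

/-- A sum over the edge ends, weighted by vertex values, of boundary derivatives vanishes if at each
vertex the value or the sum of the derivatives vanishes. -/
lemma sum_ends_eq_zero (c : V → ℂ) {u : G.L2Graph}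
    (h : ∀ v, c v = 0 ∨ G.normalDerivSum u v = 0) :
    (∑ b, c (G.start b) * -G.derivVal u (Sum.inl b) 0) +
      (∑ b, c (G.finish b) * G.derivVal u (Sum.inl b) (G.len b)) +
      ∑ k, c (G.root k) * -G.derivVal u (Sum.inr k) 0 = 0 := by
  classical
  -- No finiteness is assumed of `V`, so the regrouping runs over the finitely many vertices that
  -- edges meet.
  let S : Finset V := Finset.univ.image G.start ∪ Finset.univ.image G.finish ∪
    Finset.univ.image G.root
  rw [sum_mul_eq_sum_fiber G.start c _ (S := S) (fun i => by simp [S]),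
    sum_mul_eq_sum_fiber G.finish c _ (S := S) (fun i => by simp [S]),
    sum_mul_eq_sum_fiber G.root c _ (S := S) (fun i => by simp [S]),
    ← Finset.sum_add_distrib, ← Finset.sum_add_distrib]
  refine Finset.sum_eq_zero fun v _ => ?_
  rw [← mul_add, ← mul_add]
  rcases h v with h | h
  · rw [h, zero_mul]
  · rw [mul_eq_zero]
    right
    rw [← h, normalDerivSum]
    congr!

variable {G}

/-- A vertex that is neither exterior nor interior has no incident edge, and its derivative sum is
empty. -/
lemma MemDomain.kirchhoff_or {u : G.L2Graph} (hu : G.MemDomain u) (v : V) :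
    G.IsExterior v ∨ G.normalDerivSum u v = 0 := by
  by_cases h1 : G.IsExterior v
  · exact Or.inl h1
  by_cases h2 : G.IsInterior v
  · exact Or.inr (hu.kirchhoff v h2)
  right
  have h0 : (G.incident v).ncard = 0 := by
    unfold IsExterior at h1
    unfold IsInterior at h2
    omega
  rw [Set.ncard_eq_zero] at h0
  have hm : ∀ k, k ∉ G.incident v := fun k => by simp [h0]
  have hs : ∀ b, G.start b ≠ v := fun b h => hm (Sum.inl b) (Or.inl h)
  have hf : ∀ b, G.finish b ≠ v := fun b h => hm (Sum.inl b) (Or.inr h)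
  have hr : ∀ k, G.root k ≠ v := fun k h => hm (Sum.inr k) h
  simp [normalDerivSum, hs, hf, hr]

variable (G)

/-- The edgewise weak derivative of a function on the graph. -/
def edgeDeriv (u : G.L2Graph) : G.L2Graph := WithLp.toLp 2 fun k => weakDeriv (G.edge k) (u k)

variable {G}

omit [Fintype B] [Fintype U] in
lemma HasEdgeDeriv.edgeDeriv_eq {u p : G.L2Graph} (h : G.HasEdgeDeriv u p) :
    G.edgeDeriv u = p := by
  ext1 k
  exact (h k).weakDeriv_eq (G.isOpen_edge k)

lemma MemDomain.hasEdgeDeriv {u : G.L2Graph} (hu : G.MemDomain u) :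
    G.HasEdgeDeriv u (G.edgeDeriv u) := fun k => by
  obtain ⟨g, hg⟩ := (hu.edgewise k).memH2.hasWeakDeriv
  have : G.edgeDeriv u k = g := hg.weakDeriv_eq (G.isOpen_edge k)
  rwa [this]

lemma MemDomain.hasEdgeDeriv_edgeDeriv {u : G.L2Graph} (hu : G.MemDomain u) :
    G.HasEdgeDeriv (G.edgeDeriv u) (G.edgeDeriv (G.edgeDeriv u)) := fun k => by
  obtain ⟨g, hg⟩ := (hu.edgewise k).memH2.hasWeakDeriv' (G.isOpen_edge k)
  have : G.edgeDeriv (G.edgeDeriv u) k = g := hg.weakDeriv_eq (G.isOpen_edge k)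
  rw [this]
  exact hg

lemma HasVertexValues.memDomain {u p q : G.L2Graph} {c : V → ℂ} (hc : G.HasVertexValues u c)
    (hu : G.HasEdgeDeriv u p) (hp : G.HasEdgeDeriv p q)
    (hk : ∀ v, G.IsInterior v → G.normalDerivSum u v = 0) : G.MemDomain u := by
  refine ⟨fun k => ⟨⟨p k, q k, hu k, hp k⟩, G.exists_isContRep (hu k), ?_⟩, ⟨c,
    fun b => hc.val_eq (Sum.inl b), fun b => hc.val_eq (Sum.inr (Sum.inl b)),
    fun k => hc.val_eq (Sum.inr (Sum.inr k)), hc.exterior⟩, hk⟩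
  rw [(hu k).weakDeriv_eq (G.isOpen_edge k)]
  exact G.exists_isContRep (hp k)

/-- Green's formula: the boundary terms cancel for a function in the form domain and one in the
domain of the Hamiltonian. -/
lemma HasVertexValues.inner_add_inner {v q u : G.L2Graph} {c : V → ℂ}
    (hc : G.HasVertexValues v c) (hv : G.HasEdgeDeriv v q) (hu : G.MemDomain u) :
    inner ℂ v (G.edgeDeriv (G.edgeDeriv u)) + inner ℂ q (G.edgeDeriv u) = 0 := by
  rw [hv.inner_add_inner hu.hasEdgeDeriv_edgeDeriv,
    ← G.sum_ends_eq_zero (fun w => (starRingEnd ℂ) (c w)) (u := u) fun w =>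
      (hu.kirchhoff_or w).imp_left fun h => by rw [hc.exterior w h, map_zero]]
  have h1 := fun b => hc.val_eq (Sum.inl b)
  have h2 := fun b => hc.val_eq (Sum.inr (Sum.inl b))
  have h3 := fun k => hc.val_eq (Sum.inr (Sum.inr k))
  simp only [endEdge, endPoint, endVertex] at h1 h2 h3
  simp only [h1, h2, h3]
  rfl

omit [Fintype B] [Fintype U] in
/-- There are `H¹` functions on the graph with prescribed values at the vertices. -/
lemma exists_hasEdgeDeriv_val_eq (c : V → ℂ) : ∃ u p : G.L2Graph, G.HasEdgeDeriv u p ∧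
    ∀ e, G.val u (endEdge e) (G.endPoint e) = c (G.endVertex e) := by
  choose f f' h1 h2 h3 using fun b => exists_hasWeakDeriv_Ioo (G.len_pos b) (c (G.start b))
    (c (G.finish b))
  choose g g' k1 k2 using fun k => exists_hasWeakDeriv_Ioi (c (G.root k))
  refine ⟨WithLp.toLp 2 fun k => match k with
      | Sum.inl b => f b
      | Sum.inr k => g k,
    WithLp.toLp 2 fun k => match k with
      | Sum.inl b => f' b
      | Sum.inr k => g' k, fun k => ?_, fun e => ?_⟩
  · cases k with
    | inl b => exact h1 b
    | inr k => exact k1 k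
  · rcases e with b | b | k
    exacts [h2 b, h3 b, k2 k]

lemma inner_single [DecidableEq (B ⊕ U)] (k : B ⊕ U) (a : L2 (G.edge k)) (u : G.L2Graph) :
    inner ℂ (WithLp.toLp 2 (Pi.single k a) : G.L2Graph) u = inner ℂ a (u k) := by
  rw [PiLp.inner_apply, Finset.sum_eq_single k]
  · rw [PiLp.toLp_apply, Pi.single_eq_same]
  · intro j _ hj
    rw [PiLp.toLp_apply, Pi.single_eq_of_ne hj, inner_zero_left]
  · exact fun h => absurd (Finset.mem_univ k) h

/-! ### From the weak formulation to the resolvent equation. -/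

/-- Weak formulation implies the differential equation. -/
lemma hasEdgeDeriv_of_inner_formDomain {p q : G.L2Graph}
    (h : ∀ x ∈ G.formDomain, inner ℂ x.fst q + inner ℂ x.snd p = 0) : G.HasEdgeDeriv p q := by
  classical
  intro k φ hφ hc hs
  obtain ⟨w, w', h1, h2, h4, h5⟩ := exists_testFunction (G.isOpen_edge k) hφ hc hs
  have hder : G.HasEdgeDeriv (WithLp.toLp 2 (Pi.single k w)) (WithLp.toLp 2 (Pi.single k w')) := by
    intro j
    rcases eq_or_ne j k with rfl | hj
    · rwa [PiLp.toLp_apply, PiLp.toLp_apply, Pi.single_eq_same, Pi.single_eq_same]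
    · rw [PiLp.toLp_apply, PiLp.toLp_apply, Pi.single_eq_of_ne hj, Pi.single_eq_of_ne hj]
      exact hasWeakDeriv_zero _
  have hval : ∀ j x, x ∈ closure (G.edge j) → x ∉ G.edge j →
      G.val (WithLp.toLp 2 (Pi.single k w)) j x = 0 := by
    intro j x hx hx'
    rw [val, PiLp.toLp_apply]
    rcases eq_or_ne j k with rfl | hj
    · rw [Pi.single_eq_same]
      exact h2 x hx hx'
    · rw [Pi.single_eq_of_ne hj]
      exact (isContRep_zero _).pointValue_eq (G.isOpen_edge j) hx
  -- A test function on one edge, extended by zero, vanishes at every edge end and so lies in the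
  -- form domain with all vertex values zero.
  have := h (WithLp.toLp 2 (WithLp.toLp 2 (Pi.single k w), WithLp.toLp 2 (Pi.single k w')))
    ⟨hder, 0, fun e => hval _ _ (G.endPoint_mem_closure e) (G.endPoint_notMem e), fun _ _ => rfl⟩
  change inner ℂ (WithLp.toLp 2 (Pi.single k w) : G.L2Graph) q +
    inner ℂ (WithLp.toLp 2 (Pi.single k w') : G.L2Graph) p = 0 at this
  rw [inner_single, inner_single, h4, h5] at this
  exact eq_neg_of_add_eq_zero_right this

/-- Weak formulation implies the Kirchhoff conditions. -/
lemma normalDerivSum_eq_zero_of_inner_formDomain {u p q : G.L2Graph} (hu : G.HasEdgeDeriv u p)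
    (hp : G.HasEdgeDeriv p q)
    (h : ∀ x ∈ G.formDomain, inner ℂ x.fst q + inner ℂ x.snd p = 0) {v : V}
    (hv : G.IsInterior v) : G.normalDerivSum u v = 0 := by
  classical
  -- A function with value `1` at `v` and `0` at all other vertices is admissible since `v` is not
  -- exterior; its boundary pairing with `u'` is the derivative sum at `v`.
  obtain ⟨w, w', h1, h2⟩ := exists_hasEdgeDeriv_val_eq (G := G) (Pi.single v 1)
  have h3 := h (WithLp.toLp 2 (w, w')) ⟨h1, Pi.single v 1, h2, fun v' hv' => by
    rw [Pi.single_eq_of_ne]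
    rintro rfl
    unfold IsExterior at hv'
    unfold IsInterior at hv
    omega⟩
  change inner ℂ w q + inner ℂ w' p = 0 at h3
  rw [h1.inner_add_inner hp] at h3
  have e1 := fun b => h2 (Sum.inl b)
  have e2 := fun b => h2 (Sum.inr (Sum.inl b))
  have e3 := fun k => h2 (Sum.inr (Sum.inr k))
  simp only [endEdge, endPoint, endVertex, Pi.single_apply] at e1 e2 e3
  have e4 : ∀ k x, G.derivVal u k x = G.val p k x := fun k x => by
    rw [derivVal, (hu k).weakDeriv_eq (G.isOpen_edge k), val]
  rw [normalDerivSum]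
  refine Eq.trans ?_ h3
  simp only [e1, e2, e3, e4, apply_ite (starRingEnd ℂ), map_one, map_zero, ite_mul, one_mul,
    zero_mul]

/-- The residual of the projection is orthogonal to the form domain: this is the weak form of `-u''
+ u = f`. -/
lemma inner_formDomain_resolvent (f : G.L2Graph) {x : WithLp 2 (G.L2Graph × G.L2Graph)}
    (hx : x ∈ G.formDomain) :
    inner ℂ x.fst (G.resolvent f - f) +
      inner ℂ x.snd (G.formDomain.starProjection (WithLp.toLp 2 (f, 0))).snd = 0 := by
  have h := Submodule.inner_right_of_mem_orthogonal hx
    (G.formDomain.sub_starProjection_mem_orthogonal (WithLp.toLp 2 (f, 0)))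
  rw [WithLp.prod_inner_apply] at h
  have h' : inner ℂ x.fst (f - G.resolvent f) +
    inner ℂ x.snd (0 - (G.formDomain.starProjection (WithLp.toLp 2 (f, 0))).snd) = 0 := h
  rw [← neg_sub f, inner_neg_right, ← neg_eq_zero, ← h', zero_sub, inner_neg_right]
  ring

lemma resolvent_spec (f : G.L2Graph) : G.MemDomain (G.resolvent f) ∧
    G.edgeDeriv (G.edgeDeriv (G.resolvent f)) = G.resolvent f - f := by
  have h0 := fun x hx => inner_formDomain_resolvent (G := G) f (x := x) hx
  obtain ⟨h1, c, hc⟩ := G.mem_formDomain.1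
    (G.formDomain.starProjection_apply_mem (WithLp.toLp 2 (f, 0)))
  rw [← resolvent_apply] at h1 hc
  have h2 := hasEdgeDeriv_of_inner_formDomain h0
  refine ⟨hc.memDomain h1 h2 fun v hv => normalDerivSum_eq_zero_of_inner_formDomain h1 h2 h0 hv, ?_⟩
  rw [h1.edgeDeriv_eq, h2.edgeDeriv_eq]

/-- By Green's formula `(u - u'', 0) - (u, u') = (-u'', -u')` is orthogonal to the form domain, so
`(u, u')` is the projection of `(u - u'', 0)`. -/
lemma resolvent_sub_edgeDeriv {u : G.L2Graph} (hu : G.MemDomain u) :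
    G.resolvent (u - G.edgeDeriv (G.edgeDeriv u)) = u := by
  obtain ⟨c, hc⟩ := hu.exists_hasVertexValues
  have h : G.formDomain.starProjection
      (WithLp.toLp 2 (u - G.edgeDeriv (G.edgeDeriv u), 0)) = WithLp.toLp 2 (u, G.edgeDeriv u) := by
    refine (Submodule.eq_starProjection_of_mem_orthogonal
      (G.mem_formDomain.2 ⟨hu.hasEdgeDeriv, c, hc⟩) ?_)
    intro x hx
    obtain ⟨hx1, d, hd⟩ := G.mem_formDomain.1 hx
    rw [WithLp.prod_inner_apply]
    change inner ℂ x.fst (u - G.edgeDeriv (G.edgeDeriv u) - u) +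
      inner ℂ x.snd (0 - G.edgeDeriv u) = 0
    rw [sub_sub_cancel_left, zero_sub, inner_neg_right, inner_neg_right, ← neg_add,
      hd.inner_add_inner hx1 hu, neg_zero]
  rw [resolvent_apply, h]
  rfl

lemma injective_resolvent : Function.Injective G.resolvent := by
  intro f g h
  have h1 := (resolvent_spec f).2
  rw [h, (resolvent_spec g).2] at h1
  exact (sub_right_injective h1).symm

/-! ### The Schrödinger group. -/

variable (G)

lemma mem_graph_smul_hamiltonian (x y : G.L2Graph) :
    (x, y) ∈ ((-Complex.I) • G.hamiltonian).graph ↔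
      G.MemDomain x ∧ y = Complex.I • G.edgeDeriv (G.edgeDeriv x) := by
  have e : ∀ z : G.hamiltonian.domain, ((-Complex.I) • G.hamiltonian) z =
      Complex.I • G.edgeDeriv (G.edgeDeriv (z : G.L2Graph)) := by
    intro z
    rw [LinearPMap.smul_apply]
    have : G.hamiltonian z = -G.edgeDeriv (G.edgeDeriv (z : G.L2Graph)) := rfl
    rw [this, smul_neg, neg_smul, neg_neg]
  rw [LinearPMap.mem_graph_iff]
  constructor
  · rintro ⟨z, rfl, rfl⟩
    exact ⟨z.2, e z⟩
  · rintro ⟨hx, rfl⟩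
    exact ⟨⟨x, hx⟩, rfl, e ⟨x, hx⟩⟩

/-- The two resolvent identities put the graph of `-iH` in the form `{(K z, -i(z - K z))}` required
by the abstract theorem. -/
theorem isC0GroupGeneratedBy_schrodingerGroup :
    IsC0GroupGeneratedBy ((-Complex.I) • G.hamiltonian) G.schrodingerGroup := by
  have h : ∃ T, IsC0GroupGeneratedBy ((-Complex.I) • G.hamiltonian) T := by
    refine exists_isC0GroupGeneratedBy G.isSelfAdjoint_resolvent injective_resolvent
      fun x y => ?_
    rw [mem_graph_smul_hamiltonian]
    constructor
    · rintro ⟨hx, rfl⟩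
      refine ⟨_, (resolvent_sub_edgeDeriv hx).symm, ?_⟩
      rw [resolvent_sub_edgeDeriv hx, sub_sub_cancel_left, smul_neg, neg_smul, neg_neg]
    · rintro ⟨z, rfl, rfl⟩
      obtain ⟨h1, h2⟩ := resolvent_spec z
      refine ⟨h1, ?_⟩
      rw [h2, ← neg_sub z, smul_neg, neg_smul]
  rw [schrodingerGroup, expGroup, dif_pos h]
  exact h.choose_spec

/-! ### Balance of the probability flow. -/

variable {G}

/-- The probability flow through the ends of the bounded edges equals that into the unbounded
edges. -/
lemma MemDomain.sum_inner_sub_inner {u : G.L2Graph} (hu : G.MemDomain u) :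
    ∑ b : B, (inner ℂ (u (Sum.inl b)) (G.edgeDeriv (G.edgeDeriv u) (Sum.inl b)) -
      inner ℂ (G.edgeDeriv (G.edgeDeriv u) (Sum.inl b)) (u (Sum.inl b))) =
      ∑ k : U, probFlow (G.edge (Sum.inr k)) (u (Sum.inr k)) 0 := by
  obtain ⟨c, hc⟩ := hu.exists_hasVertexValues
  have h0 := G.sum_ends_eq_zero (fun w => (starRingEnd ℂ) (c w)) (u := u) fun w =>
    (hu.kirchhoff_or w).imp_left fun h => by rw [hc.exterior w h, map_zero]
  have h1 := fun b => hc.val_eq (Sum.inl b)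
  have h2 := fun b => hc.val_eq (Sum.inr (Sum.inl b))
  have h3 := fun k => hc.val_eq (Sum.inr (Sum.inr k))
  simp only [endEdge, endPoint, endVertex] at h1 h2 h3
  simp only [← h1, ← h2, ← h3] at h0
  -- `h0` says that `conj u` times the outward derivative sums to zero over all ends; subtracting
  -- its conjugate leaves the total outward flow.
  have h0' := congrArg (starRingEnd ℂ) h0
  simp only [map_add, map_sum, map_mul, map_neg, Complex.conj_conj, map_zero] at h0'
  have hb : ∀ b : B, inner ℂ (u (Sum.inl b)) (G.edgeDeriv (G.edgeDeriv u) (Sum.inl b)) -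
      inner ℂ (G.edgeDeriv (G.edgeDeriv u) (Sum.inl b)) (u (Sum.inl b)) =
      ((starRingEnd ℂ) (G.val u (Sum.inl b) 0) * -G.derivVal u (Sum.inl b) 0 +
        (starRingEnd ℂ) (G.val u (Sum.inl b) (G.len b)) * G.derivVal u (Sum.inl b) (G.len b)) -
      (G.val u (Sum.inl b) 0 * -(starRingEnd ℂ) (G.derivVal u (Sum.inl b) 0) +
        G.val u (Sum.inl b) (G.len b) *
          (starRingEnd ℂ) (G.derivVal u (Sum.inl b) (G.len b))) := by
    intro b
    have k1 := G.inner_add_inner_bounded (hu.hasEdgeDeriv (Sum.inl b))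
      (hu.hasEdgeDeriv_edgeDeriv (Sum.inl b))
    have k2 := G.inner_add_inner_bounded (hu.hasEdgeDeriv_edgeDeriv (Sum.inl b))
      (hu.hasEdgeDeriv (Sum.inl b))
    have e : ∀ x, G.derivVal u (Sum.inl b) x =
      pointValue (G.edge (Sum.inl b)) (G.edgeDeriv u (Sum.inl b)) x := fun _ => rfl
    simp only [e, val]
    linear_combination k1 - k2
  -- The outward normal at the end of a half-line is `-∂ₓ`, hence the overall minus sign.
  have hk : ∀ k : U, probFlow (G.edge (Sum.inr k)) (u (Sum.inr k)) 0 =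
      -((starRingEnd ℂ) (G.val u (Sum.inr k) 0) * -G.derivVal u (Sum.inr k) 0 -
        G.val u (Sum.inr k) 0 * -(starRingEnd ℂ) (G.derivVal u (Sum.inr k) 0)) := fun k => by
    rw [probFlow, val, derivVal]
    ring
  simp only [hb, hk, Finset.sum_sub_distrib, Finset.sum_add_distrib, Finset.sum_neg_distrib]
  linear_combination h0 - h0'

end MetricGraph

end

theorem mainTheorem8 {V B U : Type*} [Fintype B] [Fintype U] (G : MetricGraph V B U) :
    QuantumGraph.IsC0GroupGeneratedBy ((-Complex.I) • G.hamiltonian) G.schrodingerGroup ∧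
    ∀ (u₀ : G.L2Graph) (_ : u₀ ∈ G.hamiltonian.domain) (u : ℝ → G.L2Graph)
      (_ : ∀ t, u t = G.schrodingerGroup t u₀) (t : ℝ),
      u t ∈ G.hamiltonian.domain ∧
      DifferentiableAt ℝ (fun s => ∑ b : B, ∫ x in G.edge (Sum.inl b),
        QuantumGraph.probDensity (G.edge (Sum.inl b)) (u s (Sum.inl b)) x) t ∧
      DifferentiableAt ℝ (fun s => ∑ b : B, ‖u s (Sum.inl b)‖ ^ 2) t ∧
      Complex.I * (deriv (fun s => ∑ b : B, ∫ x in G.edge (Sum.inl b),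
          QuantumGraph.probDensity (G.edge (Sum.inl b)) (u s (Sum.inl b)) x) t : ℝ) =
        Complex.I * (deriv (fun s => ∑ b : B, ‖u s (Sum.inl b)‖ ^ 2) t : ℝ) ∧
      Complex.I * (deriv (fun s => ∑ b : B, ‖u s (Sum.inl b)‖ ^ 2) t : ℝ) =
        -∑ k : U, QuantumGraph.probFlow (G.edge (Sum.inr k)) (u t (Sum.inr k)) 0 := by
  have hT := G.isC0GroupGeneratedBy_schrodingerGroup
  refine ⟨hT, fun u₀ hu₀ u hu t => ?_⟩
  obtain rfl : u = fun t => G.schrodingerGroup t u₀ := funext hu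
  have hgraph := (G.mem_graph_smul_hamiltonian u₀ _).2 ⟨hu₀, rfl⟩
  obtain ⟨hdom, hTy⟩ := (G.mem_graph_smul_hamiltonian _ _).1 (hT.graph_apply hgraph t)
  -- The two functions of time become identical, so their equality of derivatives is trivial.
  simp only [QuantumGraph.integral_probDensity]
  choose r hr hr' using fun b : B => hT.exists_hasDerivAt_norm_sq hgraph
    (PiLp.proj 2 (𝕜 := ℂ) (fun k : B ⊕ U => QuantumGraph.L2 (G.edge k)) (Sum.inl b)) t
  have hd : HasDerivAt (fun s => ∑ b : B, ‖(G.schrodingerGroup s u₀) (Sum.inl b)‖ ^ 2)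
      (∑ b, r b) t := HasDerivAt.fun_sum fun b _ => hr b
  refine ⟨hdom, hd.differentiableAt, hd.differentiableAt, trivial, ?_⟩
  rw [hd.deriv, ← hdom.sum_inner_sub_inner, Complex.ofReal_sum, Finset.mul_sum,
    ← Finset.sum_neg_distrib]
  refine Finset.sum_congr rfl fun b _ => ?_
  rw [hr' b, hTy]
  simp only [PiLp.proj_apply, PiLp.smul_apply, inner_smul_left, inner_smul_right, Complex.conj_I]
  -- The generator contributes `i` in the linear slot and `-i` in the conjugate one; with the
  -- prefactor `i` both become real signs through `i² = -1`.
  linear_combination (inner ℂ (G.schrodingerGroup t u₀ (Sum.inl b))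
    (G.edgeDeriv (G.edgeDeriv (G.schrodingerGroup t u₀)) (Sum.inl b)) -
    inner ℂ (G.edgeDeriv (G.edgeDeriv (G.schrodingerGroup t u₀)) (Sum.inl b))
      (G.schrodingerGroup t u₀ (Sum.inl b))) * Complex.I_mul_I
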